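/- Let $K$ be a nonempty abstract simplicial complex with finite vertex set, and let $n=\dim K$. For an abstract simplicial complex $L$ with finite vertex set $S$, in which every $\{s\}$, $s\in S$, is a simplex, let $$P_L=\bigcup_{\sigma\in L\cup\{\varnothing\}}[-1,1]^\sigma\times\{-1,1\}^{S-\sigma}\subset[-1,1]^S,\qquad W_L=\langle S\mid s^2=1\ (s\in S),\ [s,t]=1\ (\{s,t\}\in L)\rangle,$$ and let $\varphi:W_L\to\{-1,1\}^S$ be the homomorphism sending the generator $s$ to the function that is $-1$ at $s$ and $1$ elsewhere; through $\varphi$, the group $W_L$ acts on $P_L$ by reflections of the coordinates. Let $bK$ be the barycentric subdivision of $K$: its vertices are the (nonempty) simplices of $K$ and its simplices are the nonempty sets of simplices of $K$ that are linearly ordered by inclusion. Put $W=W_{bK}$, and define $$\theta:\{-1,1\}^K\to\{-1,1\}^{n+1},\quad f\mapsto\Big(\prod_{\dim\sigma=i}f(\sigma)\Big)_{i=0}^n,\qquad \Gamma=(\theta\circ\varphi)^{-1}\langle(-1,\dots,-1)\rangle .$$ Then $\Gamma$ is a normal subgroup of $W$; it is virtually torsion-free (it has a torsion-free subgroup of finite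 index); and it has torsion (a nontrivial element of finite order). Moreover, let $p:X\to P_{bK}$ be a universal cover, that is, a covering map with $X$ simply connected. Then $X$ carries a reflection action of $W$: an action by homeomorphisms that covers the action of $W$ on $P_{bK}$ and for which there is a continuous lift $c$ to $X$ of the chamber $P_{bK}\cap[0,\infty)^{K}$ such that each generator $s$ fixes $c(y)$ for every $y$ in the chamber with $y_s=0$. For every such action, the restricted action of $\Gamma$ on $X$ is pseudo-free: it is proper (for the discrete topology on $\Gamma$, the map $\Gamma\times X\to X\times X$, $(g,x)\mapsto(gx,x)$, is proper), and its singular set $\{x\in X\mid gx=x\text{ for some }1\neq g\in\Gamma\}$ is discrete. -/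

import Mathlib

namespace Davis

universe u v

/-- The barycentric subdivision `bK` of an abstract simplicial complex `K`: its vertices are the
(nonempty) simplices of `K`, and its simplices are the nonempty finite sets of simplices of `K`
that are linearly ordered by inclusion. -/
def barycentric {V : Type u} (K : AbstractSimplicialComplex V) :
    AbstractSimplicialComplex K.faces where
  faces := {c | c.Nonempty ∧ IsChain (fun σ τ : K.faces => σ.1 ⊆ τ.1) (c : Set K.faces)}
  isRelLowerSet_faces := by
    rintro c ⟨hc, hchain⟩
    exact ⟨hc, fun d hdc hd => ⟨hd, hchain.mono (Finset.coe_subset.2 hdc)⟩⟩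
  singleton_mem σ := ⟨Finset.singleton_nonempty σ, by simp⟩

/-- The cubical complex `P_L = ⋃_{σ ∈ L} [-1,1]^σ × {-1,1}^{S - σ}`, as a subset of `ℝ^S`
(with the product topology), where `S` is the vertex set of `L`.
Here `σ` ranges over the simplices of `L`, the empty simplex included. -/
def cubeComplex {S : Type u} (L : AbstractSimplicialComplex S) : Set (S → ℝ) :=
  {x | ∃ σ : Finset S, (σ = ∅ ∨ σ ∈ L.faces) ∧
    (∀ s ∈ σ, x s ∈ Set.Icc (-1 : ℝ) 1) ∧ ∀ s ∉ σ, x s = 1 ∨ x s = -1}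

/-- The relators of the right-angled Coxeter group of `L`: the squares `s²` of the vertices, and
the commutators `[s,t]` of the vertices joined by an edge. -/
def coxeterRels {S : Type u} (L : AbstractSimplicialComplex S) : Set (FreeGroup S) :=
  {r | ∃ s, r = FreeGroup.of s ^ 2} ∪
  {r | ∃ s t, (∃ e ∈ L.faces, (e : Set S) = {s, t}) ∧
    r = FreeGroup.of s * FreeGroup.of t * (FreeGroup.of s)⁻¹ * (FreeGroup.of t)⁻¹}

/-- The right-angled Coxeter group `W_L = ⟨S | s² = 1, [s,t] = 1 for {s,t} ∈ L⟩`. -/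
abbrev CoxeterGroup {S : Type u} (L : AbstractSimplicialComplex S) : Type u :=
  PresentedGroup (coxeterRels L)

/-- The generator of `W_L` that corresponds to the vertex `s`. -/
def gen {S : Type u} (L : AbstractSimplicialComplex S) (s : S) : CoxeterGroup L :=
  PresentedGroup.of s

open Classical in
/-- The epimorphism `φ : W_L → {-1,1}^S` that sends the generator `s` to the function which is
`-1` at `s` and `1` elsewhere. -/
noncomputable def signs {S : Type u} (L : AbstractSimplicialComplex S) :
    CoxeterGroup L →* (S → ℤˣ) :=
  PresentedGroup.toGroup (f := fun s => Pi.mulSingle s (-1)) (by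
    rintro r (⟨s, rfl⟩ | ⟨s, t, -, rfl⟩)
    · rw [map_pow, FreeGroup.lift_apply_of, ← Pi.mulSingle_pow]
      simp
    · simp only [map_mul, map_inv]
      rw [mul_inv_cancel_comm, mul_inv_cancel])

/-- The chamber of `P_L`: its points with non-negative coordinates. -/
def chamber {S : Type u} (L : AbstractSimplicialComplex S) : Set (S → ℝ) :=
  {x | x ∈ cubeComplex L ∧ ∀ s, 0 ≤ x s}

/-- An action of `W_L` on a covering space `p : X → P_L` is the reflection action if it covers
the action of `W_L` on `P_L` by coordinate reflections, through `φ : W_L → {-1,1}^S`, and if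
there is a lift `c` of the chamber to `X` such that every generator `s` fixes pointwise the lift
of the mirror `{x_s = 0}` of the chamber.
When `X` is the universal cover, this is the standard action of `W_L`, which is unique up to the
choice of the lift of the chamber. -/
structure IsReflectionAction {S : Type u} (L : AbstractSimplicialComplex S)
    {X : Type v} [TopologicalSpace X] (p : X → cubeComplex L)
    (ρ : CoxeterGroup L →* (X ≃ₜ X)) : Prop where
  covers : ∀ (w : CoxeterGroup L) (x : X) (s : S),
    (p (ρ w x) : S → ℝ) s = ((signs L w s : ℤ) : ℝ) * (p x : S → ℝ) s
  lift_chamber : ∃ c : C(chamber L, X), (∀ y, (p (c y) : S → ℝ) = y) ∧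
    ∀ (s : S) (y : chamber L), (y : S → ℝ) s = 0 → ρ (gen L s) (c y) = c y

/-- The dimension of a finite nonempty simplicial complex: the largest `d` such that there is a
simplex with `d + 1` vertices. -/
noncomputable def dim {V : Type u} (K : AbstractSimplicialComplex V) : ℕ :=
  sSup {d | ∃ σ ∈ K.faces, σ.card = d + 1}

/-- The homomorphism `θ : {-1,1}^K → {-1,1}^{n+1}`, `n = dim K`, whose `i`-th coordinate is the
product of the values over the simplices of dimension `i`. -/
noncomputable def dimProd {V : Type u} [Finite V] (K : AbstractSimplicialComplex V) :
    (K.faces → ℤˣ) →* (Fin (dim K + 1) → ℤˣ) where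
  toFun f i := ∏ᶠ σ ∈ {σ : K.faces | σ.1.card = (i : ℕ) + 1}, f σ
  map_one' := by
    funext i
    simp
  map_mul' f g := by
    funext i
    exact finprod_mem_mul_distrib (Set.toFinite _)

/-- The subgroup `Γ = (θ ∘ φ)⁻¹ ⟨(-1, …, -1)⟩` of the right-angled Coxeter group of `bK`. -/
noncomputable def Gam {V : Type u} [Finite V] (K : AbstractSimplicialComplex V) :
    Subgroup (CoxeterGroup (barycentric K)) :=
  (Subgroup.zpowers (fun _ => -1 : Fin (dim K + 1) → ℤˣ)).comap
    ((dimProd K).comp (signs (barycentric K)))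

/-- A group has torsion if it has a nontrivial element of finite order. -/
def HasTorsion (G : Type u) [Group G] : Prop :=
  ∃ g : G, g ≠ 1 ∧ IsOfFinOrder g

/-- A group is virtually torsion-free if it has a torsion-free subgroup of finite index. -/
def IsVirtuallyTorsionFree (G : Type u) [Group G] : Prop :=
  ∃ H : Subgroup G, H.FiniteIndex ∧ ¬ HasTorsion H

/-- An action of a discrete group `G` on a space `X` is proper if `(g, x) ↦ (g x, x)` is a proper
map. -/
def IsProperAction {G : Type u} [Group G] {X : Type v} [TopologicalSpace X]
    (ρ : G →* (X ≃ₜ X)) : Prop :=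
  letI : TopologicalSpace G := ⊥
  IsProperMap (fun q : G × X => (ρ q.1 q.2, q.2))

/-- The singular set of an action: the points that are fixed by some nontrivial element. -/
def singularSet {G : Type u} [Group G] {X : Type v} [TopologicalSpace X]
    (ρ : G →* (X ≃ₜ X)) : Set X :=
  {x | ∃ g : G, g ≠ 1 ∧ ρ g x = x}

/-- An action of a discrete group is pseudo-free if it is proper and its singular set is
discrete. -/
def IsPseudoFree {G : Type u} [Group G] {X : Type v} [TopologicalSpace X]
    (ρ : G →* (X ≃ₜ X)) : Prop :=
  IsProperAction ρ ∧ IsDiscrete (singularSet ρ)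

end Davis

namespace Davis

universe u v

open Filter Topology

/-! The group `Γ` contains the kernel of `φ`, and the theorem rests on two facts about that kernel.

It is torsion-free (`eq_one_of_isOfFinOrder`). The retraction that kills one generator `s` has as
kernel a free product of conjugates of `⟨s⟩`, whose words of even length form a free group. Killing
the generators one at a time reduces the claim to free groups. All embeddings needed are exhibited
by explicit left inverses, so no normal forms enter.

It acts freely on `X` and transitively on the fibres of `p`. This comes from a developing function
`A : X → W`, a lift of `p` to a principal `W`-bundle over `P`, which records the walls crossed and
satisfies `x = A x • c (|p x|)` (`exists_coordinates`). Since `φ` has finite image, properness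
follows. An element fixing `x` is conjugate to a product of commuting generators, all from mirrors
through `p x` (`exists_conj_word_of_apply_eq`).

The barycentric subdivision enters last. A chain of simplices has at most one member in each
dimension, so `θ` is injective on sign vectors supported on a chain. A nontrivial element of `Γ`
with a fixed point `x` therefore has `θ`-image `(-1, …, -1)`, and `p x` has a vanishing coordinate
in every dimension. This forces `p x` to be the centre of its cube. There are finitely many such
centres, and their preimage is discrete. Conversely, the product of the generators along a full flag
is an involution in `Γ`. -/

section SignPow

variable {G : Type*} [Group G]

/-- The homomorphism from `{1,-1}` that is given by an involution. -/
def signPow (g : G) (hg : g * g = 1) : ℤˣ →* G where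
  toFun u := if u = -1 then g else 1
  map_one' := by simp [show (1 : ℤˣ) ≠ -1 by decide]
  map_mul' a b := by
    rcases Int.units_eq_one_or a with rfl | rfl <;> rcases Int.units_eq_one_or b with rfl | rfl <;>
      simp [show (1 : ℤˣ) ≠ -1 by decide, hg]

@[simp] lemma signPow_neg_one (g : G) (hg : g * g = 1) : signPow g hg (-1) = g := by
  simp [signPow]

end SignPow

/-! ### Right-angled Coxeter groups: presentation and universal property. -/

section Presentation

variable {S : Type u} (L : AbstractSimplicialComplex S)

lemma gen_mul_self (s : S) : gen L s * gen L s = 1 := by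
  have h : PresentedGroup.mk (coxeterRels L) (FreeGroup.of s ^ 2) = 1 :=
    PresentedGroup.one_of_mem (Or.inl ⟨s, rfl⟩)
  rw [map_pow, pow_two] at h
  exact h

lemma gen_inv (s : S) : (gen L s)⁻¹ = gen L s :=
  inv_eq_of_mul_eq_one_left (gen_mul_self L s)

/-- Two vertices span a simplex. -/
def Linked (s t : S) : Prop := ∃ e ∈ L.faces, (e : Set S) = {s, t}

variable {L}

lemma Linked.symm {s t : S} (h : Linked L s t) : Linked L t s := by
  obtain ⟨e, he, h⟩ := h
  exact ⟨e, he, by rw [h, Set.pair_comm]⟩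

lemma linked_of_mem_faces {σ : Finset S} (hσ : σ ∈ L.faces) {s t : S} (hs : s ∈ σ) (ht : t ∈ σ) :
    Linked L s t := by
  classical
  refine ⟨{s, t}, L.isRelLowerSet_faces.mem_of_le hσ ?_ (by simp), by simp⟩
  intro x hx
  rcases Finset.mem_insert.1 hx with rfl | hx
  · exact hs
  · rwa [Finset.mem_singleton.1 hx]

lemma Linked.commute {s t : S} (h : Linked L s t) : Commute (gen L s) (gen L t) := by
  have h : PresentedGroup.mk (coxeterRels L)
      (FreeGroup.of s * FreeGroup.of t * (FreeGroup.of s)⁻¹ * (FreeGroup.of t)⁻¹) = 1 :=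
    PresentedGroup.one_of_mem (Or.inr ⟨s, t, h, rfl⟩)
  simp only [map_mul, map_inv] at h
  exact commutatorElement_eq_one_iff_commute.1 h

variable {G : Type*} [Group G]

/-- The universal property of the right-angled Coxeter group. -/
def lift (f : S → G) (hf : ∀ s, f s * f s = 1)
    (hc : ∀ s t, Linked L s t → Commute (f s) (f t)) : CoxeterGroup L →* G :=
  PresentedGroup.toGroup (f := f) (by
    rintro r (⟨s, rfl⟩ | ⟨s, t, h, rfl⟩)
    · simp [pow_two, hf]
    · simp only [map_mul, map_inv, FreeGroup.lift_apply_of]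
      exact commutatorElement_eq_one_iff_commute.2 (hc s t h))

@[simp] lemma lift_gen (f : S → G) (hf : ∀ s, f s * f s = 1)
    (hc : ∀ s t, Linked L s t → Commute (f s) (f t)) (s : S) : lift f hf hc (gen L s) = f s :=
  PresentedGroup.toGroup.of _

lemma hom_ext {f g : CoxeterGroup L →* G} (h : ∀ s, f (gen L s) = g (gen L s)) : f = g :=
  PresentedGroup.ext h

lemma gen_induction {C : CoxeterGroup L → Prop} (one : C 1)
    (mul : ∀ s w, C w → C (gen L s * w)) (w : CoxeterGroup L) : C w := by
  have hw : w ∈ Subgroup.closure (Set.range (gen L)) := by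
    have := PresentedGroup.closure_range_of (coxeterRels L)
    change Subgroup.closure (Set.range (gen L)) = ⊤ at this
    simp [this]
  induction hw using Subgroup.closure_induction_left with
  | one => exact one
  | mul_left x hx y _ ih =>
    obtain ⟨s, rfl⟩ := hx
    exact mul s y ih
  | inv_mul_cancel x hx y _ ih =>
    obtain ⟨s, rfl⟩ := hx
    rw [gen_inv]
    exact mul s y ih

open Classical in
lemma signs_gen (s t : S) : signs L (gen L s) t = if t = s then -1 else 1 := by
  have : signs L (gen L s) = Pi.mulSingle s (-1) := PresentedGroup.toGroup.of _
  rw [this, Pi.mulSingle_apply]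

end Presentation

/-! ### Free products of groups of order two. -/

section FreeProduct

/-- The complex whose only simplices are the vertices. -/
def discreteComplex (I : Type u) : AbstractSimplicialComplex I where
  faces := {σ | ∃ i, σ = {i}}
  isRelLowerSet_faces := by
    rintro _ ⟨i, rfl⟩
    refine ⟨Finset.singleton_nonempty i, fun τ hτ hne => ⟨i, ?_⟩⟩
    exact (Finset.subset_singleton_iff.1 hτ).resolve_left hne.ne_empty
  singleton_mem i := ⟨i, rfl⟩

lemma Linked.eq_of_discreteComplex {I : Type u} {i j : I} (h : Linked (discreteComplex I) i j) :
    i = j := by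
  obtain ⟨_, ⟨k, rfl⟩, h⟩ := h
  have hi : i ∈ (({k} : Finset I) : Set I) := by simp [h]
  have hj : j ∈ (({k} : Finset I) : Set I) := by simp [h]
  simp only [Finset.coe_singleton, Set.mem_singleton_iff] at hi hj
  rw [hi, hj]

/-- The free product of copies of the group of order two. -/
abbrev FreeInvolutions (I : Type u) : Type u := CoxeterGroup (discreteComplex I)

namespace FreeInvolutions

variable {I : Type u} {G : Type*} [Group G]

/-- The universal property of a free product of groups of order two. -/
def lift (f : I → G) (hf : ∀ i, f i * f i = 1) : FreeInvolutions I →* G :=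
  Davis.lift f hf (fun i j h => by rw [h.eq_of_discreteComplex])

@[simp] lemma lift_gen (f : I → G) (hf : ∀ i, f i * f i = 1) (i : I) :
    lift f hf (gen _ i) = f i :=
  Davis.lift_gen _ _ _ i

/-- The homomorphism that sends every generator to `-1`. -/
def parity (I : Type u) : FreeInvolutions I →* ℤˣ := lift (fun _ => -1) (by simp)

@[simp] lemma parity_gen (i : I) : parity I (gen _ i) = -1 := lift_gen _ _ i

/-- Permutations of the factors of a free product. -/
def permAut (I : Type u) : Equiv.Perm I →* MulAut (FreeInvolutions I) where
  toFun σ := MonoidHom.toMulEquiv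
    (lift (fun i => gen _ (σ i)) (fun _ => gen_mul_self _ _))
    (lift (fun i => gen _ (σ.symm i)) (fun _ => gen_mul_self _ _))
    (hom_ext (by simp)) (hom_ext (by simp))
  map_one' := by
    refine MulEquiv.toMonoidHom_injective (hom_ext fun i => ?_)
    simp
  map_mul' σ τ := by
    refine MulEquiv.toMonoidHom_injective (hom_ext fun i => ?_)
    simp

@[simp] lemma permAut_gen (σ : Equiv.Perm I) (i : I) : permAut I σ (gen _ i) = gen _ (σ i) := by
  simp [permAut]

/-- The automorphism of a free group that inverts the generators. -/
def invertGens (I : Type u) : MulAut (FreeGroup I) :=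
  MonoidHom.toMulEquiv
    (FreeGroup.lift fun i => (FreeGroup.of i)⁻¹) (FreeGroup.lift fun i => (FreeGroup.of i)⁻¹)
    (by ext; simp) (by ext; simp)

@[simp] lemma invertGens_of (i : I) : invertGens I (FreeGroup.of i) = (FreeGroup.of i)⁻¹ := by
  simp [invertGens]

lemma invertGens_mul_self : invertGens I * invertGens I = 1 := by
  refine MulEquiv.toMonoidHom_injective ?_
  ext i
  simp

/-- An element of finite order and even length of a free product of groups of order two is
trivial. -/
lemma eq_one_of_isOfFinOrder [Nonempty I] {f : FreeInvolutions I} (hf : IsOfFinOrder f)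
    (hp : parity I f = 1) : f = 1 := by
  obtain ⟨o⟩ := ‹Nonempty I›
  -- Inverting the free generators makes each `(xᵢ, -1)` an involution, so `J` exists. The map `R`,
  -- with `xᵢ ↦ gᵢ g_o` and `-1 ↦ g_o`, is a left inverse of `J`, since `gᵢ g_o g_o = gᵢ`. Even
  -- elements land in the free factor, which is torsion-free.
  let act : ℤˣ →* MulAut (FreeGroup I) := signPow (invertGens I) invertGens_mul_self
  let J : FreeInvolutions I →* FreeGroup I ⋊[act] ℤˣ :=
    lift (fun i => SemidirectProduct.inl (FreeGroup.of i) * SemidirectProduct.inr (-1)) (fun i => by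
      ext <;> simp [act])
  let κ : FreeGroup I →* FreeInvolutions I := FreeGroup.lift fun i => gen _ i * gen _ o
  let R : FreeGroup I ⋊[act] ℤˣ →* FreeInvolutions I :=
    SemidirectProduct.lift κ (signPow (gen _ o) (gen_mul_self _ o)) (fun u => by
      rcases Int.units_eq_one_or u with rfl | rfl
      · ext; simp
      · ext i
        simp [act, κ, gen_inv, mul_assoc, gen_mul_self])
  have hRJ : R.comp J = MonoidHom.id _ := hom_ext fun i => by
    simp [R, J, κ, mul_assoc, gen_mul_self]
  have hJ : SemidirectProduct.rightHom.comp J = parity I := hom_ext fun i => by simp [J]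
  have hright : (J f).right = 1 := by
    rw [← hp, ← hJ]; rfl
  have hinl : J f = SemidirectProduct.inl (J f).left := by
    ext <;> simp [hright]
  have hfin : IsOfFinOrder (J f).left := by
    have := J.isOfFinOrder hf
    rw [hinl] at this
    exact (SemidirectProduct.inl_injective.isOfFinOrder_iff).1 this
  have h1 : (J f).left = 1 := (isOfFinOrder_iff_eq_one _).1 hfin
  rw [h1, map_one] at hinl
  have := DFunLike.congr_fun hRJ f
  simpa [hinl] using this.symm

end FreeInvolutions

end FreeProduct

/-! ### The kernel of `φ` is torsion-free. -/

section TorsionFree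

variable {S : Type u} (L : AbstractSimplicialComplex S)

open Classical in
/-- The retraction of a right-angled Coxeter group that kills the generators in `T`. -/
noncomputable def kill (T : Set S) : CoxeterGroup L →* CoxeterGroup L :=
  lift (fun t => if t ∈ T then 1 else gen L t)
    (fun s => by split_ifs <;> simp [gen_mul_self])
    (fun s t h => by
      split_ifs
      exacts [.one_left _, .one_left _, .one_right _, h.commute])

open Classical in
@[simp] lemma kill_gen (T : Set S) (t : S) :
    kill L T (gen L t) = if t ∈ T then 1 else gen L t := by
  simp [kill]

variable {L}

/-- The kernel of the retraction is generated by conjugates of `s`, indexed by cosets of the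
subgroup `A` generated by the neighbours of `s`. `Ψ` embeds `W_L` in a semidirect product of `W_L`
with a free product of involutions. The image of `k` lies in the free product and has even length
because its sign at `s` is `1`. -/
lemma eq_one_of_kill_singleton (s : S) {k : CoxeterGroup L} (hk : IsOfFinOrder k)
    (hs : signs L k s = 1) (hkill : kill L {s} k = 1) : k = 1 := by
  classical
  let A : Subgroup (CoxeterGroup L) := Subgroup.closure {g | ∃ t, Linked L s t ∧ t ≠ s ∧ g = gen L t}
  let I := CoxeterGroup L ⧸ A
  let π := kill L {s}
  let act : CoxeterGroup L →* MulAut (FreeInvolutions I) :=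
    (FreeInvolutions.permAut I).comp (MulAction.toPermHom (CoxeterGroup L) I)
  let o : I := ((1 : CoxeterGroup L) : I)
  have hact : ∀ w i, act w (gen _ i) = gen _ (w • i) := fun w i => by simp [act]
  have hcomm : ∀ t, t ≠ s → Linked L s t →
      Commute (SemidirectProduct.inl (gen _ o) : FreeInvolutions I ⋊[act] CoxeterGroup L)
        (SemidirectProduct.inr (gen L t)) := fun t hts hst => by
    have h := SemidirectProduct.inl_aut (φ := act) (gen L t) (gen _ o)
    have ho : gen L t • o = o := by
      change ((gen L t * 1 : CoxeterGroup L) : I) = _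
      rw [mul_one]
      refine (QuotientGroup.eq.2 ?_).symm
      rw [inv_one, one_mul]
      exact Subgroup.subset_closure ⟨t, hst, hts, rfl⟩
    rw [hact, ho, map_inv, eq_mul_inv_iff_mul_eq] at h
    exact h
  let Ψ : CoxeterGroup L →* FreeInvolutions I ⋊[act] CoxeterGroup L :=
    lift (fun t => if t = s then SemidirectProduct.inl (gen _ o)
        else SemidirectProduct.inr (gen L t))
      (fun t => by split_ifs <;> simp [← map_mul, gen_mul_self])
      (fun t t' h => by
        split_ifs with h1 h2 h2
        · exact .refl _
        · exact hcomm t' h2 (h1 ▸ h)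
        · exact (hcomm t h1 (h2 ▸ h.symm)).symm
        · exact h.commute.map _)
  have hA : ∀ a ∈ A, Commute (π a) (gen L s) := fun a ha => by
    have : A ≤ (Subgroup.centralizer {gen L s}).comap π := by
      rw [Subgroup.closure_le]
      rintro _ ⟨t, hst, hts, rfl⟩
      simp only [Subgroup.coe_comap, Set.mem_preimage, SetLike.mem_coe,
        Subgroup.mem_centralizer_singleton_iff, π, kill_gen, Set.mem_singleton_iff, hts, if_false]
      exact hst.symm.commute
    exact Subgroup.mem_centralizer_singleton_iff.1 (this ha)
  -- The chosen representative does not matter: by `hA`, elements of `π A` commute with `s`.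
  let c : I → CoxeterGroup L := fun i => π i.out * gen L s * (π i.out)⁻¹
  have hc : ∀ w : CoxeterGroup L, c (w : I) = π w * gen L s * (π w)⁻¹ := fun w => by
    obtain ⟨a, ha⟩ := QuotientGroup.mk_out_eq_mul A w
    have := (hA a a.2).eq
    simp only [c, ha, map_mul, mul_inv_rev, mul_assoc]
    rw [← mul_assoc (π a), this]
    simp [mul_assoc]
  let R : FreeInvolutions I ⋊[act] CoxeterGroup L →* CoxeterGroup L :=
    SemidirectProduct.lift
      (FreeInvolutions.lift c fun i => by simp [c, mul_assoc, ← mul_assoc (gen L s), gen_mul_self])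
      π (fun w => hom_ext fun i => by
        induction i using QuotientGroup.induction_on with
        | H v =>
          simp only [MonoidHom.comp_apply, MulEquiv.coe_toMonoidHom, hact,
            FreeInvolutions.lift_gen, MulAut.conj_apply]
          change c ((w * v : CoxeterGroup L) : I) = _
          rw [hc, hc]
          simp [mul_assoc])
  have hRΨ : R.comp Ψ = MonoidHom.id _ := hom_ext fun t => by
    by_cases h : t = s
    · subst h
      simp only [R, Ψ, MonoidHom.comp_apply, lift_gen, if_true, SemidirectProduct.lift_inl,
        FreeInvolutions.lift_gen]
      simp only [o, hc]
      simp
    · simp [R, Ψ, h, π]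
  have hΨ : SemidirectProduct.rightHom.comp Ψ = π := hom_ext fun t => by
    by_cases h : t = s <;> simp [Ψ, h, π]
  -- Parity is invariant under permuting the factors, so it extends to the semidirect product;
  -- pulled back along `Ψ` it is the sign at `s`.
  let q : FreeInvolutions I ⋊[act] CoxeterGroup L →* ℤˣ :=
    SemidirectProduct.lift (FreeInvolutions.parity I) 1 (fun w => hom_ext fun i => by
      simp [hact])
  have hq : q.comp Ψ = (Pi.evalMonoidHom _ s).comp (signs L) := hom_ext fun t => by
    by_cases h : t = s
    · simp [q, Ψ, h, signs_gen]
    · simp [q, Ψ, h, signs_gen, Ne.symm h]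
  have hright : (Ψ k).right = 1 := by
    rw [← hkill]
    exact DFunLike.congr_fun hΨ k
  have hinl : Ψ k = SemidirectProduct.inl (Ψ k).left := by
    ext <;> simp [hright]
  have hpar : FreeInvolutions.parity I (Ψ k).left = 1 := by
    have h := DFunLike.congr_fun hq k
    rw [MonoidHom.comp_apply, hinl] at h
    simpa [q, hs] using h
  have hfin : IsOfFinOrder (Ψ k).left := by
    have := Ψ.isOfFinOrder hk
    rw [hinl] at this
    exact (SemidirectProduct.inl_injective.isOfFinOrder_iff).1 this
  have : Nonempty I := ⟨o⟩
  rw [FreeInvolutions.eq_one_of_isOfFinOrder hfin hpar, map_one] at hinl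
  have := DFunLike.congr_fun hRΨ k
  simpa [hinl] using this.symm

/-- The kernel of `φ : W_L → {-1,1}^S` is torsion-free. -/
theorem eq_one_of_isOfFinOrder [Finite S] {k : CoxeterGroup L} (hk : IsOfFinOrder k)
    (hs : signs L k = 1) : k = 1 := by
  classical
  cases nonempty_fintype S
  -- The one-generator case is applied to `kill L T k`, whose sign at `s` is either killed or equal
  -- to that of `k`. For `T` the whole vertex set the retraction is trivial.
  have key : ∀ T : Finset S, kill L T k = 1 → k = 1 := by
    intro T
    induction T using Finset.induction_on with
    | empty =>
      intro h
      have : kill L (∅ : Set S) = MonoidHom.id _ := hom_ext fun t => by simp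
      simpa [this] using h
    | insert s T _ ih =>
      intro h
      refine ih (eq_one_of_kill_singleton s ((kill L T).isOfFinOrder hk) ?_ ?_)
      · have : ((Pi.evalMonoidHom _ s).comp (signs L)).comp (kill L T) =
            if s ∈ T then 1 else (Pi.evalMonoidHom _ s).comp (signs L) := hom_ext fun t => by
          by_cases ht : t ∈ T
          · by_cases hs : s ∈ T
            · simp [ht, hs]
            · have : s ≠ t := fun h => hs (h ▸ ht)
              simp [ht, hs, signs_gen, this]
          · by_cases hs : s ∈ T
            · have : s ≠ t := fun h => ht (h ▸ hs)
              simp [ht, hs, signs_gen, this]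
            · simp [ht, hs]
        have := DFunLike.congr_fun this k
        simp only [MonoidHom.comp_apply, Pi.evalMonoidHom_apply] at this
        rw [this]
        split_ifs
        simp [hs]
      · have : (kill L {s}).comp (kill L T) = kill L (insert s T : Finset S) := hom_ext fun t => by
          by_cases ht : t ∈ T
          · simp [ht]
          · by_cases hts : t = s
            · subst hts
              simp [ht]
            · simp [ht, hts]
        rw [← h, ← this]
        rfl
  refine key Finset.univ ?_
  have : kill L (Finset.univ : Finset S) = 1 := hom_ext fun t => by simp
  rw [this, MonoidHom.one_apply]

end TorsionFree


/-! ### Products of commuting generators. -/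

section Word

variable {S : Type u} (L : AbstractSimplicialComplex S)

/-- A set of vertices that are pairwise joined by edges. -/
def IsClique (Z : Set S) : Prop := ∀ s ∈ Z, ∀ t ∈ Z, Linked L s t

open Classical in
/-- The product, in a fixed order, of the generators at which `f` is `-1`. -/
noncomputable def word [Finite S] (f : S → ℤˣ) : CoxeterGroup L :=
  letI := Fintype.ofFinite S
  ((Finset.univ : Finset S).toList.map
    fun s => signPow (gen L s) (gen_mul_self L s) (f s)).prod

variable {L}

lemma signPow_gen_mem {H : Subgroup (CoxeterGroup L)} {s : S} {a : ℤˣ}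
    (h : a ≠ 1 → gen L s ∈ H) : signPow (gen L s) (gen_mul_self L s) a ∈ H := by
  rcases Int.units_eq_one_or a with rfl | rfl
  · simp
  · simpa using h (by decide)

lemma word_mem [Finite S] {f : S → ℤˣ} {H : Subgroup (CoxeterGroup L)}
    (h : ∀ s, f s ≠ 1 → gen L s ∈ H) : word L f ∈ H := by
  refine H.list_prod_mem fun x hx => ?_
  obtain ⟨s, -, rfl⟩ := List.mem_map.1 hx
  exact signPow_gen_mem (h s)

@[simp] lemma word_one [Finite S] : word L (1 : S → ℤˣ) = 1 :=
  Subgroup.mem_bot.1 (word_mem fun _ h => absurd rfl h)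

lemma prod_map_signPow_mul {Z : Set S} (hZ : IsClique L Z) {f g : S → ℤˣ}
    (hf : ∀ s, f s ≠ 1 → s ∈ Z) (hg : ∀ s, g s ≠ 1 → s ∈ Z) (l : List S) :
    (l.map fun s => signPow (gen L s) (gen_mul_self L s) ((f * g) s)).prod =
      (l.map fun s => signPow (gen L s) (gen_mul_self L s) (f s)).prod *
      (l.map fun s => signPow (gen L s) (gen_mul_self L s) (g s)).prod := by
  induction l with
  | nil => simp
  | cons s l ih =>
    have hcomm : Commute (signPow (gen L s) (gen_mul_self L s) (g s))
        (l.map fun s => signPow (gen L s) (gen_mul_self L s) (f s)).prod := by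
      refine Commute.list_prod_right _ _ fun x hx => ?_
      obtain ⟨t, -, rfl⟩ := List.mem_map.1 hx
      rcases Int.units_eq_one_or (g s) with h | h
      · simp [h]
      · rcases Int.units_eq_one_or (f t) with h' | h'
        · simp [h']
        · rw [h, h', signPow_neg_one, signPow_neg_one]
          exact (hZ s (hg s (by rw [h]; decide)) t (hf t (by rw [h']; decide))).commute
    rw [List.map_cons, List.prod_cons, ih]
    simp only [List.map_cons, List.prod_cons, Pi.mul_apply, map_mul]
    simp only [mul_assoc]
    rw [← mul_assoc (signPow (gen L s) _ (g s)), hcomm.eq]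
    simp only [mul_assoc]

variable [Finite S]

/-- The common clique is essential: `word` is a set-theoretic section of `φ`, and becomes
multiplicative where the generators involved commute. -/
lemma word_mul {Z : Set S} (hZ : IsClique L Z) {f g : S → ℤˣ}
    (hf : ∀ s, f s ≠ 1 → s ∈ Z) (hg : ∀ s, g s ≠ 1 → s ∈ Z) :
    word L (f * g) = word L f * word L g :=
  prod_map_signPow_mul hZ hf hg _

open Classical in
lemma word_mulSingle (s : S) : word L (Pi.mulSingle s (-1)) = gen L s := by
  have key : ∀ l : List S, l.Nodup →
      (l.map fun t => signPow (gen L t) (gen_mul_self L t)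
        ((Pi.mulSingle s (-1) : S → ℤˣ) t)).prod = if s ∈ l then gen L s else 1 := by
    intro l
    induction l with
    | nil => simp
    | cons t l ih =>
      intro h
      rw [List.nodup_cons] at h
      rw [List.map_cons, List.prod_cons, ih h.2]
      by_cases hts : t = s
      · subst hts
        simp [h.1]
      · simp [Ne.symm hts]
  unfold word
  rw [key _ (Finset.nodup_toList _)]
  simp

lemma word_commute_gen {Z : Set S} (hZ : IsClique L Z) {f : S → ℤˣ}
    (hf : ∀ s, f s ≠ 1 → s ∈ Z) {s : S} (hs : s ∈ Z) : Commute (word L f) (gen L s) :=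
  Subgroup.mem_centralizer_singleton_iff.1
    (word_mem fun t ht => Subgroup.mem_centralizer_singleton_iff.2 (hZ t (hf t ht) s hs).commute)

open Classical in
lemma signs_word (f : S → ℤˣ) : signs L (word L f) = f := by
  have key : ∀ l : List S, l.Nodup → ∀ t,
      signs L (l.map fun t => signPow (gen L t) (gen_mul_self L t) (f t)).prod t =
        if t ∈ l then f t else 1 := by
    intro l
    induction l with
    | nil => simp
    | cons s l ih =>
      intro h t
      rw [List.nodup_cons] at h
      rw [List.map_cons, List.prod_cons, map_mul, Pi.mul_apply, ih h.2]
      have : signs L (signPow (gen L s) (gen_mul_self L s) (f s)) t = if t = s then f s else 1 := by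
        rcases Int.units_eq_one_or (f s) with h' | h'
        · simp [h']
        · rw [h', signPow_neg_one, signs_gen]
      rw [this]
      by_cases hts : t = s
      · subst hts
        simp [h.1]
      · simp [hts]
  funext t
  unfold word
  rw [key _ (Finset.nodup_toList _)]
  simp

end Word

/-! ### Signs of coordinates and local sign changes. -/

section Points

variable {S : Type u} {L : AbstractSimplicialComplex S}

/-- The signs of the coordinates, where `0` counts as positive. -/
noncomputable def sgn (x : S → ℝ) : S → ℤˣ := fun s => if x s < 0 then -1 else 1

/-- The reflections of the coordinates. -/
def reflect (f : S → ℤˣ) (x : S → ℝ) : S → ℝ := fun s => ((f s : ℤ) : ℝ) * x s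

lemma continuous_reflect (f : S → ℤˣ) : Continuous (reflect f) := by
  unfold reflect
  fun_prop

@[simp] lemma reflect_one (x : S → ℝ) : reflect 1 x = x := by
  funext s; simp [reflect]

lemma reflect_mul (f g : S → ℤˣ) (x : S → ℝ) : reflect (f * g) x = reflect f (reflect g x) := by
  funext s; simp [reflect, mul_assoc]

lemma reflect_mem {x : S → ℝ} (f : S → ℤˣ) (hx : x ∈ cubeComplex L) :
    reflect f x ∈ cubeComplex L := by
  obtain ⟨σ, hσ, h1, h2⟩ := hx
  refine ⟨σ, hσ, fun s hs => ?_, fun s hs => ?_⟩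
  · have := h1 s hs
    rcases Int.units_eq_one_or (f s) with h | h
    · simpa [reflect, h] using this
    · simp only [reflect, h, Set.mem_Icc] at this ⊢
      push_cast
      constructor <;> linarith
  · rcases Int.units_eq_one_or (f s) with h | h <;> rcases h2 s hs with h' | h' <;>
      simp [reflect, h, h']

lemma sgn_mul_self (x : S → ℝ) : sgn x * sgn x = 1 := by
  funext s; exact Int.units_mul_self _

lemma reflect_sgn_abs (x : S → ℝ) : reflect (sgn x) (fun s => |x s|) = x := by
  funext s
  simp only [reflect, sgn]
  split_ifs with h
  · simp [abs_of_neg h]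
  · simp [abs_of_nonneg (not_lt.1 h)]

lemma reflect_sgn_self (x : S → ℝ) : reflect (sgn x) x = fun s => |x s| := by
  conv_lhs => rw [← reflect_sgn_abs x, ← reflect_mul]
  rw [reflect_sgn_abs, sgn_mul_self, reflect_one]

lemma abs_mem_chamber {x : S → ℝ} (hx : x ∈ cubeComplex L) : (fun s => |x s|) ∈ chamber L :=
  ⟨reflect_sgn_self x ▸ reflect_mem _ hx, fun _ => abs_nonneg _⟩

/-- Outside the simplex of a cube containing `x` the coordinates are `±1`, so the zeros lie in that
simplex. -/
lemma isClique_zeros {x : S → ℝ} (hx : x ∈ cubeComplex L) : IsClique L {s | x s = 0} := by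
  obtain ⟨σ, hσ, -, h⟩ := hx
  have key : ∀ s, x s = 0 → s ∈ σ := fun s hs => by
    by_contra hn
    rcases h s hn with h | h <;> rw [hs] at h <;> norm_num at h
  intro s hs t ht
  rcases hσ with rfl | hσ
  · exact absurd (key s hs) (by simp)
  · exact linked_of_mem_faces hσ (key s hs) (key t ht)

/-- The points whose coordinates have the signs of the nonzero coordinates of `i`. -/
def signStar (i : S → ℝ) : Set (S → ℝ) := {x | ∀ s, i s ≠ 0 → 0 < i s * x s}

lemma mem_signStar_self (x : S → ℝ) : x ∈ signStar x := fun _ h => mul_self_pos.2 h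

lemma isOpen_signStar [Finite S] (i : S → ℝ) : IsOpen (signStar i) := by
  have : signStar i = ⋂ s, {x | i s ≠ 0 → 0 < i s * x s} := by
    ext; simp [signStar]
  rw [this]
  refine isOpen_iInter_of_finite fun s => ?_
  by_cases h : i s = 0
  · simp [h]
  · simp only [ne_eq, h, not_false_eq_true, true_imp_iff]
    exact isOpen_lt continuous_const (by fun_prop)

lemma sgn_mul_sgn_of_mem_signStar {x i : S → ℝ} (hx : x ∈ signStar i) {s : S}
    (h : (sgn x * sgn i) s ≠ 1) : i s = 0 := by
  by_contra hi
  refine h ?_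
  have := hx s hi
  simp only [Pi.mul_apply, sgn]
  rcases lt_or_gt_of_ne hi with h' | h'
  · have : x s < 0 := by nlinarith
    simp [h', this]
  · have : 0 < x s := by nlinarith
    simp [h'.le.not_gt, this.le.not_gt]

lemma eventually_mem_signStar [Finite S] {Y : Type*} [TopologicalSpace Y] {q : Y → S → ℝ}
    (hq : Continuous q) (y : Y) : ∀ᶠ z in 𝓝 y, q z ∈ signStar (q y) :=
  hq.continuousAt.eventually ((isOpen_signStar _).mem_nhds (mem_signStar_self _))

lemma sgn_mul_sgn_mul (x y z : S → ℝ) : sgn x * sgn z = (sgn y * sgn z) * (sgn x * sgn y) := by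
  calc sgn x * sgn z = (sgn y * sgn y) * (sgn x * sgn z) := by rw [sgn_mul_self, one_mul]
    _ = _ := by ac_rfl

/-- The cocycle identity behind the bundle: both sign changes are supported on the zeros of `i`, a
clique, so their words multiply. -/
lemma word_sgn_mul [Finite S] {x y i : S → ℝ} (hi : i ∈ cubeComplex L) (hy : y ∈ signStar i)
    (hx : x ∈ signStar y) :
    word L (sgn x * sgn i) = word L (sgn y * sgn i) * word L (sgn x * sgn y) := by
  rw [sgn_mul_sgn_mul x y i]
  refine word_mul (isClique_zeros hi) (fun s hs => sgn_mul_sgn_of_mem_signStar hy hs)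
    fun s hs => ?_
  by_contra h
  exact (hy s h).ne' (by rw [sgn_mul_sgn_of_mem_signStar hx hs, mul_zero])

end Points

/-! ### The principal bundle and developing functions. -/

section Developing

variable {S : Type u} [Finite S] (L : AbstractSimplicialComplex S)

variable {L} in
/-- The transition functions of the principal `W_L`-bundle over `P_L`. -/
noncomputable def transition (i j x : cubeComplex L) (a : CoxeterGroup L) : CoxeterGroup L :=
  a * word L (sgn (x : S → ℝ) * sgn (i : S → ℝ)) *
    (word L (sgn (x : S → ℝ) * sgn (j : S → ℝ)))⁻¹

-- Near `y` both words acquire the same right factor `word L (sgn x * sgn y)`, which cancels; hence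
-- the transition is locally constant in `x`.
variable {L} in
lemma continuousOn_transition [TopologicalSpace (CoxeterGroup L)]
    [DiscreteTopology (CoxeterGroup L)] (i j : cubeComplex L) :
    ContinuousOn (fun z : cubeComplex L × CoxeterGroup L => transition i j z.1 z.2)
      (({x : cubeComplex L | (x : S → ℝ) ∈ signStar (i : S → ℝ)} ∩
        {x : cubeComplex L | (x : S → ℝ) ∈ signStar (j : S → ℝ)}) ×ˢ
        Set.univ) := by
  rintro ⟨y, a⟩ ⟨⟨hi, hj⟩, -⟩
  refine ContinuousAt.continuousWithinAt ?_
  have h1 : ∀ᶠ z : cubeComplex L × CoxeterGroup L in 𝓝 (y, a),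
      (z.1 : S → ℝ) ∈ signStar (y : S → ℝ) :=
    eventually_mem_signStar (q := fun z : cubeComplex L × CoxeterGroup L => (z.1 : S → ℝ))
      (by fun_prop) (y, a)
  have h2 : ∀ᶠ z : cubeComplex L × CoxeterGroup L in 𝓝 (y, a), z.2 = a :=
    continuousAt_snd.eventually (p := fun b => b = a) (by simp [nhds_discrete])
  refine tendsto_nhds_of_eventually_eq ?_
  filter_upwards [h1, h2] with z hz hza
  simp only [transition]
  rw [hza, word_sgn_mul i.2 hi hz, word_sgn_mul j.2 hj hz, mul_inv_rev, mul_assoc, mul_assoc,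
    mul_inv_cancel_left, mul_assoc]

/-- The principal `W_L`-bundle over `P_L` whose sections over the chambers are multiplied, on the
right, by the generators where they cross the mirrors. -/
noncomputable def coxeterBundle [TopologicalSpace (CoxeterGroup L)]
    [DiscreteTopology (CoxeterGroup L)] :
    FiberBundleCore (cubeComplex L) (cubeComplex L) (CoxeterGroup L) where
  baseSet i := {x | (x : S → ℝ) ∈ signStar (i : S → ℝ)}
  isOpen_baseSet i := (isOpen_signStar _).preimage continuous_subtype_val
  indexAt := id
  mem_baseSet_at x := mem_signStar_self _
  coordChange := transition
  coordChange_self i x _ a := mul_inv_cancel_right a _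
  continuousOn_coordChange i j := continuousOn_transition i j
  coordChange_comp i j k x _ a := by simp [transition, mul_assoc]

variable {L}

/-- A developing function over `q : Y → P_L`: a function to `W_L` that is locally constant, except
that it is multiplied by the generators where `q` crosses the walls. -/
def IsDeveloping {Y : Type*} [TopologicalSpace Y] (q : Y → S → ℝ) (A : Y → CoxeterGroup L) : Prop :=
  ∀ y, ∀ᶠ z in 𝓝 y, A z = A y * word L (sgn (q z) * sgn (q y))

/-- The total space of a bundle with discrete fibre covers `P_L`, so `q` lifts to it. `A` is the
fibre coordinate in the chart centred at the base point itself; comparing with the fixed chart at `q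
y` gives the jumps. -/
lemma exists_isDeveloping {X : Type*} [TopologicalSpace X] [SimplyConnectedSpace X]
    [LocallyPathConnectedSpace X] (q : C(X, cubeComplex L)) :
    ∃ A : X → CoxeterGroup L, IsDeveloping (fun x => (q x : S → ℝ)) A := by
  let : TopologicalSpace (CoxeterGroup L) := ⊥
  have : DiscreteTopology (CoxeterGroup L) := ⟨rfl⟩
  let Z := coxeterBundle L
  have hcov : IsCoveringMap Z.proj := FiberBundle.isCoveringMap (F := CoxeterGroup L) (E := Z.Fiber)
  obtain ⟨x₀⟩ : Nonempty X := inferInstance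
  obtain ⟨F, ⟨-, hF⟩, -⟩ :=
    hcov.existsUnique_continuousMap_lifts q x₀ (⟨q x₀, (1 : CoxeterGroup L)⟩ : Z.TotalSpace) rfl
  have hF' : ∀ x, (F x).1 = q x := fun x => congrFun hF x
  let A : X → CoxeterGroup L := fun x => (F x).2
  refine ⟨A, fun y => ?_⟩
  have hmem : F y ∈ (Z.localTriv (q y)).source := by
    rw [Z.mem_localTriv_source, ← Z.baseSet_at, hF']
    exact mem_signStar_self _
  have hcont : ContinuousAt (fun x => (Z.localTriv (q y) (F x)).2) y :=
    continuousAt_snd.comp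
      (((Z.localTriv (q y)).continuousAt hmem).comp (f := F) F.continuous.continuousAt)
  have hval : ∀ x, (Z.localTriv (q y) (F x)).2 =
      A x * (word L (sgn (q x : S → ℝ) * sgn (q y : S → ℝ)))⁻¹ := fun x => by
    rw [Z.localTriv_apply]
    change transition (F x).1 (q y) (F x).1 (A x) = _
    rw [transition, sgn_mul_self, word_one, mul_one, hF']
  have hev : ∀ᶠ x in 𝓝 y, (Z.localTriv (q y) (F x)).2 = (Z.localTriv (q y) (F y)).2 :=
    hcont.eventually (p := fun a => a = (Z.localTriv (q y) (F y)).2) (by simp [nhds_discrete])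
  filter_upwards [hev] with x hx
  rw [hval, hval, sgn_mul_self, word_one, inv_one, mul_one] at hx
  exact mul_inv_eq_iff_eq_mul.1 hx

namespace IsDeveloping

variable {Y : Type*} [TopologicalSpace Y] {q : Y → S → ℝ} {A B : Y → CoxeterGroup L}

lemma const_mul (hA : IsDeveloping q A) (w : CoxeterGroup L) : IsDeveloping q fun y => w * A y :=
  fun y => (hA y).mono fun z hz => by simp only [hz, mul_assoc]

lemma comp {Y' : Type*} [TopologicalSpace Y'] (hA : IsDeveloping q A) {f : Y' → Y}
    (hf : Continuous f) : IsDeveloping (q ∘ f) (A ∘ f) :=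
  fun y => hf.continuousAt.eventually (hA (f y))

/-- Jumps are right multiplications and cancel in `A * B⁻¹`: developing functions are unique up to a
left factor. -/
lemma mul_inv_eq [PreconnectedSpace Y] (hA : IsDeveloping q A) (hB : IsDeveloping q B) (y z : Y) :
    A y * (B y)⁻¹ = A z * (B z)⁻¹ := by
  have : IsLocallyConstant fun y => A y * (B y)⁻¹ := by
    refine (IsLocallyConstant.iff_eventually_eq _).2 fun y => ?_
    filter_upwards [hA y, hB y] with z h1 h2
    rw [h1, h2]
    simp [mul_assoc]
  exact this.apply_eq_of_preconnectedSpace y z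

lemma eqOn_of_sgn_eq_one [PreconnectedSpace Y] (hA : IsDeveloping q A) (hq : ∀ y, sgn (q y) = 1)
    (y z : Y) : A y = A z := by
  have h1 : IsDeveloping q (fun _ => (1 : CoxeterGroup L)) := fun y =>
    Eventually.of_forall fun z => by simp [hq]
  simpa using hA.mul_inv_eq h1 y z

end IsDeveloping

end Developing


/-! ### Local and global topology of the complex and its chamber. -/

section LocallyPathConnected

/-- The source of a local homeomorphism to a locally path-connected space is locally
path-connected. -/
lemma locallyPathConnectedSpace_of_isLocalHomeomorph {X Y : Type*} [TopologicalSpace X]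
    [TopologicalSpace Y] [LocallyPathConnectedSpace Y] {p : X → Y} (hp : IsLocalHomeomorph p) :
    LocallyPathConnectedSpace X := by
  rw [locallyPathConnectedSpace_iff_pathComponentIn_mem_nhds]
  intro x u hu hxu
  obtain ⟨e, hxe, rfl⟩ := hp x
  have hx' : e x ∈ e.target := e.map_source hxe
  have hv : e.target ∩ e.symm ⁻¹' u ∈ 𝓝 (e x) := by
    refine inter_mem (e.open_target.mem_nhds hx') ?_
    refine (e.continuousAt_symm hx').preimage_mem_nhds ?_
    rw [e.left_inv hxe]
    exact hu.mem_nhds hxu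
  obtain ⟨T, ⟨hT, hTc⟩, hTv⟩ :=
    (LocallyPathConnectedSpace.path_connected_basis (e x)).mem_iff.1 hv
  have hTt : T ⊆ e.target := fun y hy => (hTv hy).1
  have hconn : IsPathConnected (e.symm '' T) := hTc.image' (e.continuousOn_symm.mono hTt)
  refine mem_of_superset ?_ (hconn.subset_pathComponentIn
    ⟨e x, mem_of_mem_nhds hT, e.left_inv hxe⟩ ?_)
  · filter_upwards [e.continuousAt hxe |>.preimage_mem_nhds hT, e.open_source.mem_nhds hxe]
      with z hz hze
    exact ⟨e z, hz, e.left_inv hze⟩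
  · rintro _ ⟨y, hy, rfl⟩
    exact (hTv hy).2

end LocallyPathConnected

section CubeComplex

variable {S : Type u} {L : AbstractSimplicialComplex S}

lemma abs_le_one_of_mem {x : S → ℝ} (hx : x ∈ cubeComplex L) (s : S) : |x s| ≤ 1 := by
  obtain ⟨σ, -, h1, h2⟩ := hx
  by_cases hs : s ∈ σ
  · exact abs_le.2 (h1 s hs)
  · rcases h2 s hs with h | h <;> simp [h]

/-- A cube of the complex that contains two points contains the segment between them. -/
lemma combo_mem_cubeComplex {x y : S → ℝ} {σ : Finset S} (hσ : σ = ∅ ∨ σ ∈ L.faces)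
    (hx : ∀ s ∈ σ, x s ∈ Set.Icc (-1 : ℝ) 1) (hy : ∀ s ∈ σ, y s ∈ Set.Icc (-1 : ℝ) 1)
    (hxy : ∀ s ∉ σ, y s = x s) (hx1 : ∀ s ∉ σ, x s = 1 ∨ x s = -1) {a b : ℝ} (ha : 0 ≤ a)
    (hb : 0 ≤ b) (hab : a + b = 1) : a • y + b • x ∈ cubeComplex L := by
  refine ⟨σ, hσ, fun s hs => ?_, fun s hs => ?_⟩
  · exact convex_Icc (-1 : ℝ) 1 (hy s hs) (hx s hs) ha hb hab
  · have : (a • y + b • x) s = x s := by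
      simp only [Pi.add_apply, Pi.smul_apply, smul_eq_mul, hxy s hs]
      rw [← add_mul, hab, one_mul]
    rw [this]
    exact hx1 s hs

/-- Near any of its points, the cubical complex is a cone. -/
lemma exists_starConvex_ball [Fintype S] {y : S → ℝ} (hy : y ∈ cubeComplex L) :
    ∃ ε > 0, ∀ r ≤ ε, StarConvex ℝ y (Metric.ball y r ∩ cubeComplex L) := by
  -- For such `x`, a coordinate equal to `±1` off the cube of `x` has the same value at `y`. So
  -- every cube containing `x` contains `y`.
  have h : ∀ᶠ x in 𝓝 y, ∀ s, (|y s| < 1 → |x s| < 1) ∧ |x s - y s| < 1 := by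
    refine eventually_all.2 fun s => ?_
    have hc : Tendsto (fun x : S → ℝ => x s) (𝓝 y) (𝓝 (y s)) := (continuous_apply s).continuousAt
    refine Eventually.and ?_ ?_
    · by_cases hs : |y s| < 1
      · exact (hc.abs.eventually_lt_const hs).mono fun x hx _ => hx
      · exact Eventually.of_forall fun x h => absurd h hs
    · have h0 : Tendsto (fun x : S → ℝ => |x s - y s|) (𝓝 y) (𝓝 |y s - y s|) :=
        (hc.sub_const _).abs
      exact h0.eventually_lt_const (by simp)
  obtain ⟨ε, hε, hball⟩ := Metric.eventually_nhds_iff_ball.1 h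
  refine ⟨ε, hε, fun r hr x hx a b ha hb hab => ⟨?_, ?_⟩⟩
  · have hr0 : 0 < r := dist_nonneg.trans_lt hx.1
    exact convex_ball y r (Metric.mem_ball_self hr0) hx.1 ha hb hab
  · have hxε := hball x (Metric.ball_subset_ball hr hx.1)
    obtain ⟨σ, hσ, h1, h2⟩ := hx.2
    refine combo_mem_cubeComplex hσ h1 (fun s _ => abs_le.1 (abs_le_one_of_mem hy s))
      (fun s hs => ?_) h2 ha hb hab
    obtain ⟨h3, h4⟩ := hxε s
    have h5 : |x s| = 1 := by rcases h2 s hs with h | h <;> simp [h]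
    have h6 : |y s| = 1 := le_antisymm (abs_le_one_of_mem hy s)
      (not_lt.1 fun h => (h3 h).ne h5)
    rw [abs_lt] at h4
    rcases eq_or_eq_neg_of_abs_eq h5 with h | h <;>
      rcases eq_or_eq_neg_of_abs_eq h6 with h' | h' <;> rw [h, h'] <;> rw [h, h'] at h4 <;>
      norm_num at h4

instance [Finite S] : LocallyPathConnectedSpace (cubeComplex L) := by
  cases nonempty_fintype S
  have hε := fun y : cubeComplex L => exists_starConvex_ball y.2
  choose ε hε0 hε using hε
  refine LocallyPathConnectedSpace.of_bases (p := fun y r => 0 < r ∧ r ≤ ε y)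
    (s := fun y r => Metric.ball y r) (fun y => ?_) (fun y r hr => ?_)
  · refine Metric.nhds_basis_ball.to_hasBasis (fun r hr => ?_) fun r hr => ⟨r, hr.1, subset_rfl⟩
    exact ⟨min r (ε y), ⟨lt_min hr (hε0 y), min_le_right _ _⟩,
      Metric.ball_subset_ball (min_le_left _ _)⟩
  · rw [Topology.IsInducing.subtypeVal.isPathConnected_iff]
    have : (Subtype.val '' Metric.ball y r : Set (S → ℝ)) =
        Metric.ball (y : S → ℝ) r ∩ cubeComplex L := by
      ext x
      constructor
      · rintro ⟨z, hz, rfl⟩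
        exact ⟨hz, z.2⟩
      · rintro ⟨hx, hxP⟩
        exact ⟨⟨x, hxP⟩, hx, rfl⟩
    rw [this]
    exact (hε y r hr.2).isPathConnected ⟨Metric.mem_ball_self hr.1, y.2⟩

variable (L) in
/-- The homeomorphism of the cubical complex that is given by reflections of the coordinates. -/
def reflectMap (f : S → ℤˣ) : C(cubeComplex L, cubeComplex L) where
  toFun x := ⟨reflect f x, reflect_mem f x.2⟩
  continuous_toFun := by
    have := continuous_reflect f
    fun_prop

@[simp] lemma coe_reflectMap (f : S → ℤˣ) (x : cubeComplex L) :
    (reflectMap L f x : S → ℝ) = reflect f x := rfl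

variable (L) in
/-- The inclusion of the chamber. -/
def chamberIncl : C(chamber L, cubeComplex L) where
  toFun x := ⟨x, x.2.1⟩

@[simp] lemma coe_chamberIncl (y : chamber L) : (chamberIncl L y : S → ℝ) = y := rfl

variable (L) in
/-- The retraction to the chamber. -/
def fold : C(cubeComplex L, chamber L) where
  toFun x := ⟨fun s => |(x : S → ℝ) s|, abs_mem_chamber x.2⟩
  continuous_toFun := Continuous.subtype_mk
    (continuous_pi fun s => ((continuous_apply s).comp continuous_subtype_val).abs) _

@[simp] lemma coe_fold (x : cubeComplex L) (s : S) :
    (fold L x : S → ℝ) s = |(x : S → ℝ) s| := rfl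

lemma fold_chamberIncl (y : chamber L) : fold L (chamberIncl L y) = y := by
  ext s
  exact abs_of_nonneg (y.2.2 s)

instance [Finite S] : LocallyPathConnectedSpace (chamber L) := by
  refine Topology.IsQuotientMap.locallyPathConnectedSpace (f := fold L) ?_
  refine Topology.IsQuotientMap.of_comp (f := chamberIncl L) (map_continuous _) (map_continuous _) ?_
  have : fold L ∘ chamberIncl L = id := funext fold_chamberIncl
  rw [this]
  exact Topology.IsQuotientMap.id

open Classical in
/-- The point of the chamber that has the coordinates `0` on `σ` and `1` elsewhere. -/
noncomputable def corner (σ : Set S) : S → ℝ := fun s => if s ∈ σ then 0 else 1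

lemma corner_apply_of_mem {σ : Set S} {s : S} (h : s ∈ σ) : corner σ s = 0 := by simp [corner, h]

lemma corner_apply_of_notMem {σ : Set S} {s : S} (h : s ∉ σ) : corner σ s = 1 := by
  simp [corner, h]

lemma corner_mem_Icc (σ : Set S) (s : S) : corner σ s ∈ Set.Icc (0 : ℝ) 1 := by
  by_cases h : s ∈ σ <;> simp [corner, h]

lemma corner_mem_chamber {σ : Finset S} (hσ : σ = ∅ ∨ σ ∈ L.faces) :
    corner (σ : Set S) ∈ chamber L := by
  refine ⟨⟨σ, hσ, fun s _ => ?_, fun s hs => Or.inl (corner_apply_of_notMem (by simpa using hs))⟩,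
    fun s => (corner_mem_Icc _ s).1⟩
  have := corner_mem_Icc (σ : Set S) s
  exact ⟨by linarith [this.1], this.2⟩

lemma corner_empty_mem_chamber : corner (∅ : Set S) ∈ chamber L := by
  simpa using corner_mem_chamber (L := L) (σ := ∅) (Or.inl rfl)

lemma corner_singleton_mem_chamber (s : S) : corner {s} ∈ chamber L := by
  simpa using corner_mem_chamber (L := L) (σ := {s}) (Or.inr (L.singleton_mem s))

variable (L) in
/-- The faces of the chamber are cones. -/
lemma starConvex_chamber (τ : Set S) :
    StarConvex ℝ (corner τ) {y | y ∈ chamber L ∧ ∀ s ∈ τ, y s = 0} := by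
  rintro y ⟨⟨hyP, hy0⟩, hyτ⟩ a b ha hb hab
  refine ⟨⟨?_, fun s => ?_⟩, fun s hs => ?_⟩
  · obtain ⟨σ, hσ, h1, h2⟩ := hyP
    have h3 : ∀ s ∉ σ, y s = 1 := fun s hs =>
      (h2 s hs).resolve_right fun h => by linarith [hy0 s]
    refine combo_mem_cubeComplex hσ h1 (fun s _ => ?_) (fun s hs => ?_) h2 ha hb hab
    · have := corner_mem_Icc τ s
      exact ⟨by linarith [this.1], this.2⟩
    · rw [h3 s hs]
      exact corner_apply_of_notMem fun h => by
        have := hyτ s h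
        rw [h3 s hs] at this
        norm_num at this
  · simp only [Pi.add_apply, Pi.smul_apply, smul_eq_mul]
    have := (corner_mem_Icc τ s).1
    have := hy0 s
    positivity
  · simp [corner_apply_of_mem hs, hyτ s hs]

instance : ContractibleSpace (chamber L) := by
  have h := starConvex_chamber L ∅
  simp only [Set.mem_empty_iff_false, false_imp_iff, implies_true, and_true, Set.ofPred_mem_eq] at h
  exact h.contractibleSpace ⟨_, corner_empty_mem_chamber⟩

/-- The mirrors of the chamber are connected. -/
lemma isPreconnected_mirror (s : S) :
    IsPreconnected {y : chamber L | (y : S → ℝ) s = 0} := by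
  refine IsPathConnected.isConnected ?_ |>.isPreconnected
  rw [Topology.IsInducing.subtypeVal.isPathConnected_iff]
  have : (Subtype.val '' {y : chamber L | (y : S → ℝ) s = 0} : Set (S → ℝ)) =
      {y | y ∈ chamber L ∧ ∀ t ∈ ({s} : Set S), y t = 0} := by
    ext x
    simp [and_comm]
  rw [this]
  exact (starConvex_chamber L {s}).isPathConnected
    ⟨corner_singleton_mem_chamber s, fun t ht => corner_apply_of_mem ht⟩

-- Each reflected chamber is connected, neighbouring ones share a mirror point, and every sign
-- pattern is `φ` of some word.
open Classical in
instance [Finite S] : PreconnectedSpace (cubeComplex L) := by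
  refine preconnectedSpace_of_forall_constant fun F hF => ?_
  let o : chamber L := ⟨corner ∅, corner_empty_mem_chamber⟩
  have h1 : ∀ (f : S → ℤˣ) (y z : chamber L),
      F (reflectMap L f (chamberIncl L y)) = F (reflectMap L f (chamberIncl L z)) := fun f y z =>
    PreconnectedSpace.constant inferInstance
      (f := fun y => F (reflectMap L f (chamberIncl L y))) (by fun_prop)
  have h2 : ∀ w : CoxeterGroup L, ∀ y : chamber L,
      F (reflectMap L (signs L w) (chamberIncl L y)) = F (chamberIncl L o) := fun w => by
    induction w using gen_induction with
    | one =>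
      intro y
      rw [h1 _ y o]
      congr 1
      ext s
      simp
    | mul s w ih =>
      intro y
      let b : chamber L := ⟨corner {s}, corner_singleton_mem_chamber s⟩
      rw [← ih b, h1 _ y b]
      congr 1
      ext t
      by_cases hts : t = s
      · subst hts
        simp [reflect, b, corner]
      · simp [reflect, signs_gen, hts]
  have h3 : ∀ x, F x = F (chamberIncl L o) := fun x => by
    rw [← h2 (word L (sgn (x : S → ℝ))) (fold L x), signs_word]
    congr 1
    ext1
    exact (reflect_sgn_abs _).symm
  intro x y
  rw [h3 x, h3 y]

end CubeComplex

/-! ### Existence of the reflection action. -/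

section Existence

variable {S : Type u} {L : AbstractSimplicialComplex S} {X : Type v}
  [TopologicalSpace X] {p : X → cubeComplex L}

lemma locallyPathConnectedSpace_of_cover [Finite S] (hp : IsCoveringMap p) : LocallyPathConnectedSpace X :=
  locallyPathConnectedSpace_of_isLocalHomeomorph hp.isLocalHomeomorph

lemma reflectMap_mulSingle_of_eq_zero [DecidableEq S] {s : S} {x : cubeComplex L}
    (h : (x : S → ℝ) s = 0) : reflectMap L (Pi.mulSingle s (-1)) x = x := by
  ext t
  by_cases hts : t = s
  · subst hts
    simp [reflect, h]
  · simp [reflect, hts]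

variable [Finite S] [SimplyConnectedSpace X]

/-- The chamber has a lift to every nonempty covering space of the cubical complex. -/
lemma exists_lift_chamber (hp : IsCoveringMap p) :
    ∃ c : C(chamber L, X), ∀ y, p (c y) = chamberIncl L y := by
  let o : chamber L := ⟨corner ∅, corner_empty_mem_chamber⟩
  obtain ⟨x⟩ : Nonempty X := inferInstance
  have : ConnectedSpace (cubeComplex L) := { toNonempty := ⟨p x⟩ }
  have : PathConnectedSpace (cubeComplex L) := .of_locallyPathConnectedSpace
  let γ := PathConnectedSpace.somePath (p x) (chamberIncl L o)
  obtain ⟨Γ, hΓ, -⟩ := hp.exists_path_lifts γ.toContinuousMap x γ.source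
  have h1 : p (Γ 1) = chamberIncl L o := (congrFun hΓ 1).trans γ.target
  obtain ⟨c, ⟨-, hc⟩, -⟩ := hp.existsUnique_continuousMap_lifts (chamberIncl L) o (Γ 1) h1
  exact ⟨c, fun y => congrFun hc y⟩

/-- The universal cover of the cubical complex carries a reflection action. -/
theorem exists_isReflectionAction (hp : IsCoveringMap p) :
    ∃ ρ : CoxeterGroup L →* (X ≃ₜ X), IsReflectionAction L p ρ := by
  classical
  have := locallyPathConnectedSpace_of_cover hp
  obtain ⟨c, hc⟩ := exists_lift_chamber hp
  let b : S → chamber L := fun s => ⟨corner {s}, corner_singleton_mem_chamber s⟩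
  have hb : ∀ s, (b s : S → ℝ) s = 0 := fun s => corner_apply_of_mem rfl
  -- Lift each reflection so that it fixes a mirror point of the lifted chamber. The Coxeter
  -- relations then follow from unique lifting, checked at one fixed point: `c (b s)` for squares,
  -- and the corner of the edge for commutators.
  have hex : ∀ s, ∃ R : C(X, X), R (c (b s)) = c (b s) ∧
      ∀ x, p (R x) = reflectMap L (Pi.mulSingle s (-1)) (p x) := fun s => by
    obtain ⟨R, ⟨h1, h2⟩, -⟩ := hp.existsUnique_continuousMap_lifts
      ((reflectMap L (Pi.mulSingle s (-1))).comp ⟨p, hp.continuous⟩) (c (b s)) (c (b s)) (by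
        simp only [ContinuousMap.comp_apply, ContinuousMap.coe_mk, hc]
        exact (reflectMap_mulSingle_of_eq_zero (hb s)).symm)
    exact ⟨R, h1, fun x => congrFun h2 x⟩
  choose R hRb hRp using hex
  have hRmirror : ∀ s (y : chamber L), (y : S → ℝ) s = 0 → R s (c y) = c y := fun s y hy => by
    refine hp.eqOn_of_comp_eqOn (isPreconnected_mirror s) (g₁ := R s ∘ c) (g₂ := c)
      (by fun_prop) (by fun_prop) (fun z hz => ?_) (hb s) (hRb s) hy
    simp only [Function.comp_apply, hRp, hc]
    exact reflectMap_mulSingle_of_eq_zero hz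
  have hmul : ∀ s t x, p (R s (R t x)) =
      reflectMap L (Pi.mulSingle s (-1) * Pi.mulSingle t (-1)) (p x) := fun s t x => by
    rw [hRp, hRp]
    ext1
    simp [reflect_mul]
  have hinv : ∀ s x, R s (R s x) = x := fun s => by
    refine congrFun (hp.eq_of_comp_eq (g₁ := R s ∘ R s) (g₂ := id) (by fun_prop) (by fun_prop)
      (funext fun x => ?_) (c (b s)) ?_)
    · simp only [Function.comp_apply, hmul, id]
      ext1
      rw [← Pi.mulSingle_mul]
      simp
    · simp [hRb]
  have hcomm : ∀ s t, Linked L s t → ∀ x, R s (R t x) = R t (R s x) := fun s t h => by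
    obtain ⟨e, he, hst⟩ := h
    let y : chamber L := ⟨corner e, corner_mem_chamber (Or.inr he)⟩
    have hs : R s (c y) = c y := hRmirror s y (corner_apply_of_mem (by simp [hst]))
    have ht : R t (c y) = c y := hRmirror t y (corner_apply_of_mem (by simp [hst]))
    refine congrFun (hp.eq_of_comp_eq (g₁ := R s ∘ R t) (g₂ := R t ∘ R s) (by fun_prop)
      (by fun_prop) (funext fun x => ?_) (c y) ?_)
    · simp only [Function.comp_apply, hmul]
      rw [mul_comm]
    · simp [hs, ht]
  let H : S → (X ≃ₜ X) := fun s =>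
    { toFun := R s
      invFun := R s
      left_inv := hinv s
      right_inv := hinv s
      continuous_toFun := map_continuous (R s)
      continuous_invFun := map_continuous (R s) }
  let ρ : CoxeterGroup L →* (X ≃ₜ X) := lift H (fun s => Homeomorph.ext (hinv s))
    (fun s t h => Homeomorph.ext (hcomm s t h))
  have hρ : ∀ s x, ρ (gen L s) x = R s x := fun s x => DFunLike.congr_fun (lift_gen H _ _ s) x
  refine ⟨ρ, ⟨fun w => ?_, c, fun y => ?_, fun s y hy => ?_⟩⟩
  · induction w using gen_induction with
    | one => intro x s; simp
    | mul s w ih =>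
      intro x t
      have h : ρ (gen L s * w) x = R s (ρ w x) := by
        rw [map_mul, ← hρ]
        rfl
      rw [h, hRp]
      simp only [coe_reflectMap, reflect, ih, map_mul, Pi.mul_apply, Units.val_mul, Int.cast_mul,
        mul_assoc, Pi.mulSingle_apply, signs_gen]
  · rw [hc, coe_chamberIncl]
  · rw [hρ, hRmirror s y hy]

end Existence


/-! ### Developing functions and reflections. -/

section Crossing

variable {S : Type u} {L : AbstractSimplicialComplex S}

open Classical in
/-- The generator `s` at the points of its mirror, and `1` elsewhere. -/
noncomputable def mirrorGen (L : AbstractSimplicialComplex S) (s : S) (x : S → ℝ) :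
    CoxeterGroup L :=
  if x s = 0 then gen L s else 1

open Classical in
lemma sgn_reflect_mulSingle {s : S} {x : S → ℝ} (h : x s ≠ 0) :
    sgn (reflect (Pi.mulSingle s (-1)) x) = Pi.mulSingle s (-1) * sgn x := by
  funext t
  by_cases hts : t = s
  · subst hts
    rcases lt_or_gt_of_ne h with h | h
    · simp [sgn, reflect, h, h.le]
    · simp [sgn, reflect, h, h.le]
  · simp [sgn, reflect, hts]

-- As `0` counts as positive, reflecting a point on the mirror leaves its sign vector alone. The
-- factor `mirrorGen` corrects for this, so that `A (s x) * mirrorGen` is again developing.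
open Classical in
lemma word_reflect_mul_mirrorGen [Finite S] {x y : S → ℝ} (hy : y ∈ cubeComplex L) (hx : x ∈ signStar y)
    (s : S) :
    word L (sgn (reflect (Pi.mulSingle s (-1)) x) * sgn (reflect (Pi.mulSingle s (-1)) y)) *
      mirrorGen L s x = mirrorGen L s y * word L (sgn x * sgn y) := by
  have hfix : ∀ z : S → ℝ, z s = 0 → reflect (Pi.mulSingle s (-1)) z = z := fun z hz => by
    funext t
    by_cases hts : t = s
    · subst hts
      simp [reflect, hz]
    · simp [reflect, hts]
  have hsupp : ∀ t, (sgn x * sgn y) t ≠ 1 → t ∈ {t | y t = 0} :=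
    fun t ht => sgn_mul_sgn_of_mem_signStar hx ht
  by_cases hys : y s = 0
  · rw [hfix y hys]
    by_cases hxs : x s = 0
    · simp only [hfix x hxs, mirrorGen, hxs, hys, if_true]
      exact (word_commute_gen (isClique_zeros hy) hsupp hys).eq
    · rw [sgn_reflect_mulSingle hxs, mul_assoc, word_mul (isClique_zeros hy) _ hsupp,
        word_mulSingle]
      · simp [mirrorGen, hxs, hys]
      · intro t ht
        by_cases hts : t = s
        · exact hts ▸ hys
        · exact absurd (Pi.mulSingle_eq_of_ne hts _) ht
  · have hxs : x s ≠ 0 := fun h => by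
      have := hx s hys
      simp [h] at this
    rw [sgn_reflect_mulSingle hxs, sgn_reflect_mulSingle hys]
    have : (Pi.mulSingle s (-1) * sgn x) * (Pi.mulSingle s (-1) * sgn y) = sgn x * sgn y := by
      calc _ = (Pi.mulSingle s (-1) * Pi.mulSingle s (-1) : S → ℤˣ) * (sgn x * sgn y) := by ac_rfl
        _ = _ := by rw [← Pi.mulSingle_mul]; simp
    rw [this]
    simp [mirrorGen, hxs, hys]

end Crossing

/-- The elements of a group acting on `X` that fix the point `x`. -/
def fixer {G : Type*} [Group G] {X : Type*} [TopologicalSpace X] (ρ : G →* (X ≃ₜ X)) (x : X) :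
    Subgroup G where
  carrier := {g | ρ g x = x}
  one_mem' := by simp
  mul_mem' {a b} ha hb := by
    change ρ (a * b) x = x
    rw [map_mul]
    change ρ a (ρ b x) = x
    rw [show ρ b x = x from hb, show ρ a x = x from ha]
  inv_mem' {a} ha := by
    change ρ a⁻¹ x = x
    rw [map_inv]
    exact (ρ a).symm_apply_eq.2 (show ρ a x = x from ha).symm

lemma mem_fixer {G : Type*} [Group G] {X : Type*} [TopologicalSpace X] {ρ : G →* (X ≃ₜ X)} {x : X}
    {g : G} : g ∈ fixer ρ x ↔ ρ g x = x := Iff.rfl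

lemma map_mul_apply {G : Type*} [Group G] {X : Type*} [TopologicalSpace X] (ρ : G →* (X ≃ₜ X))
    (g h : G) (x : X) : ρ (g * h) x = ρ g (ρ h x) := by
  rw [map_mul]; rfl

lemma map_inv_apply_self {G : Type*} [Group G] {X : Type*} [TopologicalSpace X] (ρ : G →* (X ≃ₜ X))
    (g : G) (x : X) : ρ g⁻¹ (ρ g x) = x := by
  rw [← map_mul_apply, inv_mul_cancel, map_one]; rfl

/-! ### Stabilizers and properness of a reflection action. -/

namespace IsReflectionAction

variable {S : Type u} [Finite S] {L : AbstractSimplicialComplex S} {X : Type v}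
  [TopologicalSpace X] [SimplyConnectedSpace X] {p : X → cubeComplex L}
  {ρ : CoxeterGroup L →* (X ≃ₜ X)}

omit [Finite S] [SimplyConnectedSpace X] in
lemma apply_eq (h : IsReflectionAction L p ρ) (w : CoxeterGroup L) (x : X) :
    p (ρ w x) = reflectMap L (signs L w) (p x) := by
  ext s
  exact h.covers w x s

/-- The structure of a reflection action on the universal cover: there is a developing function
that identifies the points of `X` with translates of points of the chamber. -/
lemma exists_coordinates (h : IsReflectionAction L p ρ) (hp : IsCoveringMap p) :
    ∃ (c : chamber L → X) (A : X → CoxeterGroup L),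
      (∀ (s : S) (y : chamber L), (y : S → ℝ) s = 0 → ρ (gen L s) (c y) = c y) ∧
      (∀ x, ρ (A x) (c (fold L (p x))) = x) ∧
      (∀ x, signs L (A x) = sgn (p x : S → ℝ)) ∧
      ∀ w, (∀ x, ρ w x = x) → w = 1 := by
  classical
  have := locallyPathConnectedSpace_of_cover hp
  obtain ⟨c, hc, hcs⟩ := h.lift_chamber
  replace hc : ∀ y, p (c y) = chamberIncl L y := fun y => Subtype.ext (hc y)
  obtain ⟨A₀, hA₀⟩ := exists_isDeveloping (⟨p, hp.continuous⟩ : C(X, cubeComplex L))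
  let o : chamber L := ⟨corner ∅, corner_empty_mem_chamber⟩
  let b : S → chamber L := fun s => ⟨corner {s}, corner_singleton_mem_chamber s⟩
  have hb : ∀ s, (b s : S → ℝ) s = 0 := fun s => corner_apply_of_mem rfl
  let A : X → CoxeterGroup L := fun x => (A₀ (c o))⁻¹ * A₀ x
  have hA : IsDeveloping (fun x => (p x : S → ℝ)) A := hA₀.const_mul _
  have hsgn : ∀ y : chamber L, sgn (y : S → ℝ) = 1 := fun y => by
    funext s
    simp [sgn, (y.2.2 s).not_gt]
  have hAc : ∀ y, A (c y) = 1 := fun y => by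
    have h1 := hA.comp (map_continuous c)
    refine (h1.eqOn_of_sgn_eq_one (fun y => ?_) y o).trans (inv_mul_cancel _)
    simp only [Function.comp_apply, hc, coe_chamberIncl, hsgn]
  have hsigns : ∀ s : S, signs L (gen L s) = Pi.mulSingle s (-1) := fun s => by
    funext t
    rw [signs_gen, Pi.mulSingle_apply]
  have hcont : Continuous fun x => (p x : S → ℝ) := continuous_subtype_val.comp hp.continuous
  have hgen : ∀ s x, A (ρ (gen L s) x) * mirrorGen L s (p x) = gen L s * A x := fun s x => by
    have hdev : IsDeveloping (fun x => (p x : S → ℝ))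
        fun x => A (ρ (gen L s) x) * mirrorGen L s (p x) := fun y => by
      filter_upwards [(hA.comp (ρ (gen L s)).continuous) y,
        eventually_mem_signStar hcont y] with z hz hzy
      simp only [Function.comp_apply, h.apply_eq, coe_reflectMap, hsigns] at hz
      simp only [hz, mul_assoc, word_reflect_mul_mirrorGen (p y).2 hzy]
    -- The constant ratio is evaluated on the mirror of the lifted chamber, where `A = 1` and the
    -- correction is `s`.
    have h1 := hdev.mul_inv_eq hA x (c (b s))
    rw [hcs s _ (hb s), hAc, hc] at h1
    rw [mul_inv_eq_iff_eq_mul.1 h1]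
    simp [mirrorGen, hb]
  have hequiv : ∀ w x, (∀ s, (p x : S → ℝ) s ≠ 0) → A (ρ w x) = w * A x := fun w x hx => by
    induction w using gen_induction with
    | one => simp
    | mul s w ih =>
      have h1 := hgen s (ρ w x)
      have h2 : mirrorGen L s (p (ρ w x)) = 1 := by
        rw [mirrorGen, if_neg]
        rw [h.apply_eq]
        simpa [reflect] using hx s
      rwa [h2, mul_one, ih, ← map_mul_apply, ← mul_assoc] at h1
  have hAsigns : ∀ x, signs L (A x) = sgn (p x : S → ℝ) := fun x => by
    have hloc : IsLocallyConstant fun x => signs L (A x) * sgn (p x : S → ℝ) := by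
      refine (IsLocallyConstant.iff_eventually_eq _).2 fun y => (hA y).mono fun z hz => ?_
      simp only [hz, map_mul, signs_word]
      calc _ = signs L (A y) * sgn (p y : S → ℝ) * (sgn (p z : S → ℝ) * sgn (p z : S → ℝ)) := by
            ac_rfl
        _ = _ := by rw [sgn_mul_self, mul_one]
    have h1 := hloc.apply_eq_of_preconnectedSpace x (c o)
    rw [hAc, map_one, hc, coe_chamberIncl, hsgn, one_mul] at h1
    rw [← mul_one (signs L (A x)), ← sgn_mul_self (p x : S → ℝ), ← mul_assoc, h1, one_mul]
  have hcf : Continuous fun x => c (fold L (p x)) :=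
    (map_continuous c).comp ((map_continuous (fold L)).comp hp.continuous)
  have hg : Continuous fun x => ρ (A x) (c (fold L (p x))) := by
    refine continuous_iff_continuousAt.2 fun y => tendsto_def.2 fun U hU => ?_
    -- `A` jumps at `y` only by words in mirrors through `p y`. These are finitely many and fix `c
    -- (fold L (p y))`, so the jumps do not break continuity.
    have h1 : ∀ᶠ z in 𝓝 y, ∀ f : S → ℤˣ, (∀ s, f s ≠ 1 → (p y : S → ℝ) s = 0) →
        ρ (A y) (ρ (word L f) (c (fold L (p z)))) ∈ U := by
      refine eventually_all.2 fun f => ?_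
      by_cases hf : ∀ s, f s ≠ 1 → (p y : S → ℝ) s = 0
      · have hfix : ρ (word L f) (c (fold L (p y))) = c (fold L (p y)) :=
          mem_fixer.1 (word_mem fun s hs => hcs s _ (by simp [hf s hs]))
        have hcont : Continuous fun z => ρ (A y) (ρ (word L f) (c (fold L (p z)))) :=
          (ρ (A y)).continuous.comp ((ρ (word L f)).continuous.comp hcf)
        have hU' : U ∈ 𝓝 (ρ (A y) (ρ (word L f) (c (fold L (p y))))) := by rwa [hfix]
        exact (hcont.continuousAt.eventually_mem hU').mono fun z hz _ => hz
      · exact Eventually.of_forall fun z h => absurd h hf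
    filter_upwards [h1, hA y, eventually_mem_signStar hcont y] with z hz hAz hzy
    rw [Set.mem_preimage, hAz, map_mul_apply]
    exact hz _ fun s hs => sgn_mul_sgn_of_mem_signStar hzy hs
  refine ⟨c, A, hcs, fun x => ?_, hAsigns, fun w hw => ?_⟩
  · refine congrFun (hp.eq_of_comp_eq (g₂ := id) hg continuous_id (funext fun x => ?_) (c o) ?_) x
    · simp only [Function.comp_apply, h.apply_eq, hAsigns, hc, id]
      ext1
      exact reflect_sgn_abs _
    · simp only [hAc, hc, fold_chamberIncl, map_one]
      rfl
  -- No coordinate of `o` vanishes, so `A` is equivariant at `c o`; this yields faithfulness.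
  · have h1 := hequiv w (c o) fun s => by
      rw [hc, coe_chamberIncl]
      simp [o, corner]
    rw [hw, hAc, mul_one] at h1
    exact h1.symm

/-- The kernel of `φ` acts freely on the universal cover. -/
lemma eq_one_of_apply_eq (h : IsReflectionAction L p ρ) (hp : IsCoveringMap p)
    {k : CoxeterGroup L} (hk : signs L k = 1) {x : X} (hx : ρ k x = x) : k = 1 := by
  obtain ⟨c, A, -, -, -, hone⟩ := h.exists_coordinates hp
  refine hone k fun y => congrFun (hp.eq_of_comp_eq (g₁ := ρ k) (g₂ := id) (ρ k).continuous
    continuous_id (funext fun z => ?_) x hx) y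
  simp only [Function.comp_apply, h.apply_eq, hk, id]
  ext1
  exact reflect_one _

/-- The kernel of `φ` acts transitively on the fibres of the universal cover. -/
lemma exists_apply_eq (h : IsReflectionAction L p ρ) (hp : IsCoveringMap p) {x y : X}
    (hxy : p x = p y) : ∃ k, signs L k = 1 ∧ ρ k x = y := by
  obtain ⟨c, A, -, hA, hs, -⟩ := h.exists_coordinates hp
  refine ⟨A y * (A x)⁻¹, ?_, ?_⟩
  · rw [map_mul, map_inv, hs, hs, hxy, mul_inv_cancel]
  · calc ρ (A y * (A x)⁻¹) x = ρ (A y) (ρ (A x)⁻¹ (ρ (A x) (c (fold L (p x))))) := by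
          rw [map_mul_apply, hA]
      _ = ρ (A y) (c (fold L (p y))) := by rw [map_inv_apply_self, hxy]
      _ = y := hA y

/-- The stabilizers are conjugate to the special subgroups of simplices. -/
lemma exists_conj_word_of_apply_eq (h : IsReflectionAction L p ρ) (hp : IsCoveringMap p)
    {w : CoxeterGroup L} {x : X} (hw : ρ w x = x) :
    ∃ a f, w = a * word L f * a⁻¹ ∧ ∀ s, f s ≠ 1 → (p x : S → ℝ) s = 0 := by
  obtain ⟨c, A, hc, hA, hs, -⟩ := h.exists_coordinates hp
  have hzero : ∀ s, signs L w s ≠ 1 → (p x : S → ℝ) s = 0 := fun s hs => by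
    have h1 := h.covers w x s
    rw [hw, (Int.units_eq_one_or _).resolve_left hs] at h1
    push_cast at h1
    linarith
  set y := c (fold L (p x))
  set v := (A x)⁻¹ * w * A x
  have hv : v ∈ fixer ρ y := by
    rw [mem_fixer, map_mul_apply, hA, map_mul_apply, hw]
    exact (congrArg (ρ (A x)⁻¹) (hA x)).symm.trans (map_inv_apply_self ρ (A x) y)
  have hvs : signs L v = signs L w := by
    simp only [v, map_mul, map_inv]
    rw [mul_comm, mul_inv_cancel_left]
  have hword : word L (signs L w) ∈ fixer ρ y :=
    word_mem fun s hs => hc s _ (by simp [hzero s hs])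
  -- Both factors fix `y` and have the same signs, so the quotient lies in the freely acting kernel.
  have h1 : v * (word L (signs L w))⁻¹ = 1 := by
    refine h.eq_one_of_apply_eq hp (x := y) ?_ (mem_fixer.1 (mul_mem hv (inv_mem hword)))
    rw [map_mul, map_inv, signs_word, hvs, mul_inv_cancel]
  refine ⟨A x, signs L w, ?_, hzero⟩
  rw [← mul_inv_eq_one.1 h1]
  simp [v, mul_assoc]

/-- Every subgroup of `W_L` that contains the kernel of `φ` acts properly on the universal
cover. -/
lemma isProperAction (h : IsReflectionAction L p ρ) (hp : IsCoveringMap p)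
    (Γ : Subgroup (CoxeterGroup L)) (hΓ : (signs L).ker ≤ Γ) :
    IsProperAction (ρ.comp Γ.subtype) := by
  let : TopologicalSpace Γ := ⊥
  have : DiscreteTopology Γ := ⟨rfl⟩
  change IsProperMap fun q : Γ × X => (ρ q.1 q.2, q.2)
  have hcontρ : Continuous fun q : Γ × X => ρ q.1 q.2 :=
    continuous_prod_of_discrete_left.2 fun g => (ρ g).continuous
  rw [isProperMap_iff_ultrafilter]
  refine ⟨hcontρ.prodMk continuous_snd, fun U => ?_⟩
  rintro ⟨y, x⟩ hU
  have hU1 : Tendsto (fun q : Γ × X => ρ q.1 q.2) U (𝓝 y) := (continuous_fst.tendsto _).comp hU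
  have hU2 : Tendsto (fun q : Γ × X => q.2) U (𝓝 x) := (continuous_snd.tendsto _).comp hU
  -- There are finitely many sign vectors, so an ultrafilter selects one.
  obtain ⟨f, hf⟩ : ∃ f : S → ℤˣ, ∀ᶠ q : Γ × X in U, signs L q.1 = f := by
    refine Ultrafilter.eventually_exists_iff.1 ?_
    exact Eventually.of_forall fun q => ⟨_, rfl⟩
  obtain ⟨⟨g₀, _⟩, hg₀⟩ := hf.exists
  have hpy : p y = p (ρ g₀ x) := by
    have h1 : Tendsto (fun q : Γ × X => p (ρ q.1 q.2)) U (𝓝 (p y)) :=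
      (hp.continuous.tendsto _).comp hU1
    have h2 : Tendsto (fun q : Γ × X => reflectMap L f (p q.2)) U (𝓝 (reflectMap L f (p x))) :=
      ((map_continuous (reflectMap L f)).comp hp.continuous |>.tendsto _).comp hU2
    rw [h.apply_eq, hg₀]
    refine tendsto_nhds_unique (h1.congr' ?_) h2
    filter_upwards [hf] with q hq
    rw [h.apply_eq, hq]
  obtain ⟨k, hk, hky⟩ := h.exists_apply_eq hp hpy.symm
  let g : Γ := ⟨k, hΓ hk⟩ * g₀
  have hgs : signs L g = f := by
    change signs L (k * g₀) = f
    rw [map_mul, hk, one_mul, hg₀]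
  have hgy : ρ g x = y := by
    rw [← hky, ← map_mul_apply]
    rfl
  refine ⟨(g, x), by simp [hgy], ?_⟩
  -- Eventually `q.1 • q.2` and `g • q.2` lie in one neighbourhood where `p` is injective and have
  -- the same image. So they agree, and freeness of the kernel gives `q.1 = g`.
  obtain ⟨N, hN, hNy, hinj⟩ := hp.isLocalHomeomorph.isLocallyInjective y
  have hU3 : Tendsto (fun q : Γ × X => ρ g q.2) U (𝓝 y) := by
    rw [← hgy]
    exact ((ρ g).continuous.tendsto x).comp hU2
  have heq : ∀ᶠ q : Γ × X in U, q.1 = g := by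
    filter_upwards [hf, hU1.eventually_mem (hN.mem_nhds hNy), hU3.eventually_mem (hN.mem_nhds hNy)]
      with q hq h1 h2
    have h3 : ρ q.1 q.2 = ρ g q.2 := hinj h1 h2 (by rw [h.apply_eq, h.apply_eq, hq, hgs])
    have h4 : ((g : CoxeterGroup L))⁻¹ * q.1 = 1 := by
      refine h.eq_one_of_apply_eq hp (x := q.2) ?_ ?_
      · rw [map_mul, map_inv, hgs, hq, inv_mul_cancel]
      · rw [map_mul_apply, h3, map_inv_apply_self]
    exact Subtype.ext (inv_mul_eq_one.1 h4).symm
  exact tendsto_id'.1 ((tendsto_nhds_of_eventually_eq heq).prodMk_nhds hU2)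

end IsReflectionAction


/-! ### Chains of simplices and the group `Γ`. -/

section Barycentric

variable {V : Type u} {K : AbstractSimplicialComplex V}

lemma linked_barycentric_iff {σ τ : K.faces} :
    Linked (barycentric K) σ τ ↔ σ.1 ⊆ τ.1 ∨ τ.1 ⊆ σ.1 := by
  classical
  constructor
  · rintro ⟨e, ⟨-, he⟩, hst⟩
    by_cases h : σ = τ
    · exact Or.inl (h ▸ subset_rfl)
    · exact he (by simp [hst]) (by simp [hst]) h
  · intro h
    refine ⟨{σ, τ}, ⟨by simp, ?_⟩, by simp⟩
    rintro a ha b hb -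
    simp only [Finset.coe_insert, Finset.coe_singleton, Set.mem_insert_iff,
      Set.mem_singleton_iff] at ha hb
    rcases ha with rfl | rfl <;> rcases hb with rfl | rfl
    exacts [Or.inl subset_rfl, h, h.symm, Or.inl subset_rfl]

lemma Linked.eq_of_card_eq {σ τ : K.faces} (h : Linked (barycentric K) σ τ)
    (hc : σ.1.card = τ.1.card) : σ = τ := by
  rcases linked_barycentric_iff.1 h with h | h
  · exact Subtype.ext (Finset.eq_of_subset_of_card_le h hc.ge)
  · exact Subtype.ext (Finset.eq_of_subset_of_card_le h hc.le).symm

variable [Finite V]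

variable (K) in
lemma bddAbove_dims : BddAbove {d | ∃ σ ∈ K.faces, σ.card = d + 1} := by
  cases nonempty_fintype V
  refine ⟨Fintype.card V, ?_⟩
  rintro d ⟨σ, -, hσ⟩
  have := Finset.card_le_univ σ
  omega

lemma exists_card_eq (σ : K.faces) : ∃ i : Fin (dim K + 1), σ.1.card = (i : ℕ) + 1 := by
  have hpos : 0 < σ.1.card := Finset.card_pos.2 (K.isRelLowerSet_faces.prop_of_mem σ.2)
  have h : σ.1.card - 1 ≤ dim K := le_csSup (bddAbove_dims K) ⟨σ.1, σ.2, by omega⟩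
  exact ⟨⟨σ.1.card - 1, by omega⟩, by simp only; omega⟩

variable (K) in
lemma exists_card_eq_dim [Nonempty V] : ∃ σ ∈ K.faces, σ.card = dim K + 1 := by
  obtain ⟨v⟩ := ‹Nonempty V›
  exact Nat.sSup_mem (s := {d | ∃ σ ∈ K.faces, σ.card = d + 1})
    ⟨0, {v}, K.singleton_mem v, by simp⟩ (bddAbove_dims K)

lemma dimProd_apply (f : K.faces → ℤˣ) (i : Fin (dim K + 1)) :
    dimProd K f i = ∏ᶠ σ ∈ {σ : K.faces | σ.1.card = (i : ℕ) + 1}, f σ := rfl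

lemma exists_ne_one_of_dimProd_ne_one {f : K.faces → ℤˣ} {i : Fin (dim K + 1)}
    (h : dimProd K f i ≠ 1) : ∃ σ : K.faces, σ.1.card = (i : ℕ) + 1 ∧ f σ ≠ 1 := by
  by_contra! hn
  exact h (finprod_mem_eq_one_of_forall_eq_one hn)

/-- Two comparable simplices of equal dimension coincide, so the product over one dimension has a
single nontrivial factor. -/
lemma dimProd_eq_of_card_eq {f : K.faces → ℤˣ} {Z : Set K.faces}
    (hZ : IsClique (barycentric K) Z) (hf : ∀ σ, f σ ≠ 1 → σ ∈ Z) {σ : K.faces} (hσ : f σ ≠ 1)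
    {i : Fin (dim K + 1)} (hi : σ.1.card = (i : ℕ) + 1) : dimProd K f i = f σ := by
  rw [dimProd_apply, finprod_eq_single _ σ fun τ hτ => ?_]
  · simp [hi]
  · by_cases hτi : τ ∈ {σ : K.faces | σ.1.card = (i : ℕ) + 1}
    swap
    · simp [hτi]
    suffices f τ = 1 by simp [this]
    by_contra h
    exact hτ ((hZ τ (hf τ h) σ (hf σ hσ)).eq_of_card_eq (hτi.trans hi.symm))

lemma eq_one_of_dimProd_eq_one {f : K.faces → ℤˣ} {Z : Set K.faces}
    (hZ : IsClique (barycentric K) Z) (hf : ∀ σ, f σ ≠ 1 → σ ∈ Z) (h : dimProd K f = 1) :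
    f = 1 := by
  funext σ
  by_contra hσ
  obtain ⟨i, hi⟩ := exists_card_eq σ
  have := dimProd_eq_of_card_eq hZ hf hσ hi
  rw [h] at this
  exact hσ this.symm

variable (K) in
/-- There is an involution in `W_{bK}` that is the product of the vertices of a maximal simplex of
`bK`. -/
lemma exists_full_flag [Nonempty V] : ∃ f : K.faces → ℤˣ,
    IsClique (barycentric K) {σ | f σ ≠ 1} ∧ dimProd K f = fun _ => -1 := by
  classical
  obtain ⟨τ, hτ, hcard⟩ := exists_card_eq_dim K
  let e : Fin (dim K + 1) ↪ V := (τ.equivFinOfCardEq hcard).symm.toEmbedding.trans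
    (Function.Embedding.subtype _)
  have hsub : ∀ i, (Finset.Iic i).map e ∈ K.faces := fun i => by
    refine K.isRelLowerSet_faces.mem_of_le hτ (fun x hx => ?_) (by simp)
    obtain ⟨j, -, rfl⟩ := Finset.mem_map.1 hx
    exact ((τ.equivFinOfCardEq hcard).symm j).2
  -- The flag of initial segments of an ordered top-dimensional simplex; the `i`-th has `i + 1`
  -- vertices, hence dimension `i`.
  let F : Fin (dim K + 1) → K.faces := fun i => ⟨(Finset.Iic i).map e, hsub i⟩
  have hF : ∀ i, (F i).1.card = (i : ℕ) + 1 := fun i => by simp [F]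
  let f : K.faces → ℤˣ := fun σ => if σ ∈ Set.range F then -1 else 1
  have hf : ∀ σ, f σ ≠ 1 → σ ∈ Set.range F := fun σ h => by
    by_contra hn
    exact h (if_neg hn)
  have hfF : ∀ i, f (F i) = -1 := fun i => if_pos ⟨i, rfl⟩
  have hclique : IsClique (barycentric K) (Set.range F) := by
    rintro _ ⟨i, rfl⟩ _ ⟨j, rfl⟩
    refine linked_barycentric_iff.2 ((le_total i j).imp (fun h => ?_) fun h => ?_) <;>
      exact Finset.map_subset_map.2 (Finset.Iic_subset_Iic.2 h)
  refine ⟨f, fun σ hσ ρ hρ => hclique σ (hf σ hσ) ρ (hf ρ hρ), funext fun i => ?_⟩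
  rw [dimProd_eq_of_card_eq hclique hf (σ := F i) (by rw [hfF]; decide) (hF i), hfF]

lemma mem_Gam {w : CoxeterGroup (barycentric K)} :
    w ∈ Gam K ↔ dimProd K (signs _ w) = 1 ∨ dimProd K (signs _ w) = fun _ => -1 := by
  change dimProd K (signs _ w) ∈ Subgroup.zpowers _ ↔ _
  rw [Subgroup.mem_zpowers_iff]
  have hneg : (fun _ => -1 : Fin (dim K + 1) → ℤˣ) * (fun _ => -1) = 1 := by
    funext i; simp
  constructor
  · rintro ⟨k, hk⟩
    rw [← hk]
    rcases Int.even_or_odd k with ⟨m, rfl⟩ | ⟨m, rfl⟩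
    · left
      rw [← two_mul, zpow_mul, zpow_two, hneg, one_zpow]
    · right
      rw [zpow_add, zpow_mul, zpow_two, hneg, one_zpow, one_mul, zpow_one]
  · rintro (h | h)
    · exact ⟨0, by rw [h, zpow_zero]⟩
    · exact ⟨1, by rw [h, zpow_one]⟩

lemma ker_signs_le_Gam : (signs (barycentric K)).ker ≤ Gam K := fun w hw => by
  rw [mem_Gam, MonoidHom.mem_ker.1 hw, map_one]
  exact Or.inl rfl

variable (K) in
lemma hasTorsion_Gam [Nonempty V] : HasTorsion (Gam K) := by
  obtain ⟨f, hf, hdim⟩ := exists_full_flag K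
  refine ⟨⟨word _ f, mem_Gam.2 (Or.inr (by rw [signs_word, hdim]))⟩, fun h => ?_, ?_⟩
  · have h1 : f = 1 := by
      rw [← signs_word (L := barycentric K) f, show word _ f = 1 from congrArg Subtype.val h,
        map_one]
    rw [h1, map_one] at hdim
    exact absurd (congrFun hdim 0) (by simp)
  · refine isOfFinOrder_iff_pow_eq_one.2 ⟨2, two_pos, Subtype.ext ?_⟩
    have h1 : f * f = 1 := funext fun σ => Int.units_mul_self _
    have h2 := word_mul hf (f := f) (g := f) (fun _ h => h) fun _ h => h
    rw [h1, word_one] at h2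
    simpa [pow_two] using h2.symm

variable (K) in
lemma isVirtuallyTorsionFree_Gam : IsVirtuallyTorsionFree (Gam K) := by
  refine ⟨((signs (barycentric K)).comp (Gam K).subtype).ker, inferInstance, ?_⟩
  rintro ⟨⟨⟨w, hw⟩, hk⟩, hne, hfin⟩
  refine hne (Subtype.ext (Subtype.ext (eq_one_of_isOfFinOrder ?_ hk)))
  exact (Gam K).subtype.isOfFinOrder ((Subgroup.subtype _).isOfFinOrder hfin)

/-- The points that are fixed by nontrivial elements of `Γ` lie over the centres of the cubes of
maximal dimension. -/
lemma coord_mem_of_fixed {X : Type v} [TopologicalSpace X] [SimplyConnectedSpace X]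
    {p : X → cubeComplex (barycentric K)} (hp : IsCoveringMap p)
    {ρ : CoxeterGroup (barycentric K) →* (X ≃ₜ X)} (h : IsReflectionAction (barycentric K) p ρ)
    {w : CoxeterGroup (barycentric K)} (hw : w ∈ Gam K) (hw1 : w ≠ 1) {x : X} (hx : ρ w x = x)
    (σ : K.faces) : (p x : K.faces → ℝ) σ ∈ ({0, 1, -1} : Set ℝ) := by
  obtain ⟨a, f, rfl, hf⟩ := h.exists_conj_word_of_apply_eq hp hx
  have hclique := isClique_zeros (p x).2
  have hsigns : signs (barycentric K) (a * word _ f * a⁻¹) = f := by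
    rw [map_mul, map_mul, map_inv, signs_word, mul_comm, inv_mul_cancel_left]
  rw [mem_Gam, hsigns] at hw
  rcases hw with hw | hw
  · have := eq_one_of_dimProd_eq_one hclique hf hw
    exact absurd (by rw [this]; simp) hw1
  · obtain ⟨c, hc, -, hoff⟩ := (p x).2
    have hmem : ∀ τ, (p x : K.faces → ℝ) τ = 0 → τ ∈ c := fun τ hτ => by
      by_contra hn
      rcases hoff τ hn with h | h <;> rw [hτ] at h <;> norm_num at h
    by_cases hσ : σ ∈ c
    · obtain ⟨i, hi⟩ := exists_card_eq σ
      obtain ⟨τ, hτi, hτ⟩ := exists_ne_one_of_dimProd_ne_one (f := f) (i := i)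
        (by rw [hw]; simp)
      have hcf : c ∈ (barycentric K).faces := hc.resolve_left fun h => by simp [h] at hσ
      -- Some simplex `τ` of the dimension of `σ` has vanishing coordinate; `σ` and `τ` both lie in
      -- the chain `c`, so they coincide.
      have : σ = τ := (linked_of_mem_faces hcf hσ (hmem τ (hf τ hτ))).eq_of_card_eq
        (hi.trans hτi.symm)
      exact Or.inl (this ▸ hf τ hτ)
    · exact Or.inr (hoff σ hσ)

/-- The singular set lies over a finite set of points, and the fibres of a covering are discrete. -/
lemma isDiscrete_singularSet {X : Type v} [TopologicalSpace X] [SimplyConnectedSpace X]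
    {p : X → cubeComplex (barycentric K)} (hp : IsCoveringMap p)
    {ρ : CoxeterGroup (barycentric K) →* (X ≃ₜ X)} (h : IsReflectionAction (barycentric K) p ρ) :
    IsDiscrete (singularSet (ρ.comp (Gam K).subtype)) := by
  let D : Set (cubeComplex (barycentric K)) :=
    {y | ∀ σ, (y : K.faces → ℝ) σ ∈ ({0, 1, -1} : Set ℝ)}
  have hD : D.Finite := by
    have : {y : K.faces → ℝ | ∀ σ, y σ ∈ ({0, 1, -1} : Set ℝ)}.Finite :=
      Set.Finite.pi' fun _ => Set.toFinite _
    exact this.preimage Subtype.val_injective.injOn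
  have hdisc : IsDiscrete (p ⁻¹' D) :=
    hD.isDiscrete.preimage' hp.continuous.continuousOn fun y => ⟨(hp y).discreteTopology_fiber⟩
  refine hdisc.mono ?_
  rintro x ⟨⟨w, hw⟩, hw1, hx⟩ σ
  exact coord_mem_of_fixed hp h hw (fun h => hw1 (Subtype.ext h)) hx σ

end Barycentric

end Davis

theorem lemma3p1 {V : Type*} [Finite V] [Nonempty V] (K : AbstractSimplicialComplex V) :
    (Davis.Gam K).Normal ∧
    Davis.IsVirtuallyTorsionFree (Davis.Gam K) ∧
    Davis.HasTorsion (Davis.Gam K) ∧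
    ∀ (X : Type*) [TopologicalSpace X] [SimplyConnectedSpace X]
      (p : X → Davis.cubeComplex (Davis.barycentric K)), IsCoveringMap p →
      (∃ ρ : Davis.CoxeterGroup (Davis.barycentric K) →* (X ≃ₜ X),
        Davis.IsReflectionAction (Davis.barycentric K) p ρ) ∧
      ∀ ρ : Davis.CoxeterGroup (Davis.barycentric K) →* (X ≃ₜ X),
        Davis.IsReflectionAction (Davis.barycentric K) p ρ →
          Davis.IsPseudoFree (ρ.comp (Davis.Gam K).subtype) := by
  refine ⟨?_, Davis.isVirtuallyTorsionFree_Gam K, Davis.hasTorsion_Gam K, ?_⟩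
  -- Normality holds because `Γ` is the preimage of a subgroup of an abelian group.
  · unfold Davis.Gam
    infer_instance
  · intro X _ _ p hp
    exact ⟨Davis.exists_isReflectionAction hp, fun ρ hρ =>
      ⟨hρ.isProperAction hp _ Davis.ker_signs_le_Gam, Davis.isDiscrete_singularSet hp hρ⟩⟩
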